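/- Let $R$ be a finite valuation ring, that is, a finite commutative ring with identity that is local and in which every ideal is principal. Let $(\pi)$ be its maximal ideal, let $q=|R/(\pi)|$ be the size of its residue field, and let $\ell$ be the smallest positive integer with $\pi^\ell=0$. Assume that $q$ is odd. Write $R^{n,u}$ for the set of unimodular $n$-tuples over $R$, i.e. those $a\in R^n$ whose entries generate $R$ as an ideal, and $a\cdot b=a_1b_1+\cdots+a_nb_n$. For $n\ge 2$, let $\mathrm{Um}(R^n)$ be the bipartite graph on two copies of $R^{n,u}$ in which $a$ in the first copy and $b$ in the second copy are adjacent exactly when $a\cdot b=1$. For $n\ge 3$, let $\mathrm{Um}_0(R^n)$ be the bipartite graph on two copies of $R^{n,u}/R^\times$ (unimodular tuples modulo scaling by units) in which $[a]$ in the first copy and $[b]$ in the second copy are adjacent exactly when $a\cdot b=0$. Eigenvalues of a graph are those of its adjacency matrix, listed without multiplicity. (i) For $n\ge 2$, the set of eigenvalues of $\mathrm{Um}(R^n)$ consists exactly of $$\pm q^{(n-1)\ell},\qquad \pm q^{(n-1)\ell-n/2},\qquad \pm q^{(n-1)(\ell-k/2)}\ \ (k=1,\dots,\ell),$$ together with $0$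 in the case when $R$ is not a field. (ii) For $n\ge 3$, the set of eigenvalues of $\mathrm{Um}_0(R^n)$ consists exactly of $$\pm q^{(n-2)(\ell-1)}\,\frac{q^{n-1}-1}{q-1},\qquad \pm q^{(n-2)(\ell-k/2)}\ \ (k=1,\dots,\ell).$$ -/

import Mathlib

/-- The bipartite graph on two copies of `V`, in which `a` (first copy, `Sum.inl`) and `b`
(second copy, `Sum.inr`) are adjacent whenever `r a b`. -/
def bipartiteGraphOf {V : Type*} (r : V → V → Prop) : SimpleGraph (V ⊕ V) where
  Adj
    | Sum.inl a, Sum.inr b => r a b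
    | Sum.inr b, Sum.inl a => r a b
    | _, _ => False
  symm := ⟨by rintro (a | a) (b | b) h <;> exact h⟩
  loopless := ⟨by rintro (a | a) h <;> exact h⟩

/-- The unimodular `n`-tuples over `R`: those whose entries generate `R` as an ideal. -/
def UnimodularTuple (R : Type*) [CommRing R] (n : ℕ) : Type _ :=
  {a : Fin n → R // Ideal.span (Set.range a) = ⊤}

instance (R : Type*) [CommRing R] [Finite R] (n : ℕ) : Finite (UnimodularTuple R n) :=
  inferInstanceAs (Finite {a : Fin n → R // Ideal.span (Set.range a) = ⊤})

/-- The equivalence relation on unimodular tuples of being in the same orbit under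
scaling by units of `R`. -/
def unimodularTupleSetoid (R : Type*) [CommRing R] (n : ℕ) : Setoid (UnimodularTuple R n) :=
  (MulAction.orbitRel Rˣ (Fin n → R)).comap Subtype.val

/-- The set of unimodular `n`-tuples over `R`, modulo units of `R`. -/
def ProjUnimodularTuple (R : Type*) [CommRing R] (n : ℕ) : Type _ :=
  Quotient (unimodularTupleSetoid R n)

instance (R : Type*) [CommRing R] [Finite R] (n : ℕ) : Finite (ProjUnimodularTuple R n) :=
  inferInstanceAs (Finite (Quotient (unimodularTupleSetoid R n)))

/-- The relation `a · b = 0`, on unimodular tuples modulo units. -/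
def ProjUnimodularTuple.Orthogonal {R : Type*} [CommRing R] {n : ℕ}
    (x y : ProjUnimodularTuple R n) : Prop :=
  Quotient.liftOn₂ x y (fun a b => dotProduct a.1 b.1 = 0) (by
    rintro a b c d ⟨u, hu⟩ ⟨v, hv⟩
    have hu' : u • c.1 = a.1 := hu
    have hv' : v • d.1 = b.1 := hv
    simp only [← hu', ← hv', smul_dotProduct, dotProduct_smul, smul_eq_zero_iff_eq])

/-- The graph `Um(R^n)`. -/
def unimodularGraph (R : Type*) [CommRing R] (n : ℕ) :
    SimpleGraph (UnimodularTuple R n ⊕ UnimodularTuple R n) :=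
  bipartiteGraphOf fun a b => dotProduct a.1 b.1 = 1

/-- The graph `Um₀(R^n)`. -/
def unimodularGraphZero (R : Type*) [CommRing R] (n : ℕ) :
    SimpleGraph (ProjUnimodularTuple R n ⊕ ProjUnimodularTuple R n) :=
  bipartiteGraphOf fun x y => x.Orthogonal y

open Classical in
/-- The set of (complex) eigenvalues of the adjacency matrix of a finite graph. -/
noncomputable def adjacencyEigenvalues {V : Type*} [Finite V] (G : SimpleGraph V) : Set ℂ :=
  letI : Fintype V := Fintype.ofFinite V
  {z | Module.End.HasEigenvalue (Matrix.toLin' (G.adjMatrix ℂ)) z}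

/-! Both graphs come from a symmetric 0-1 relation matrix A, so their eigenvalues are the square
roots of those of A², whose entries count common neighbours. That count depends only on how close
two points are π-adically. Hence A² is a combination of the matrices E_0, ..., E_m of a chain of
ever finer equivalence relations, from the total relation to equality, where all classes of E_i have
one size s_i.

A coarser E_i absorbs a finer E_j up to the factor s_j (`relMatrix_mul_of_le`). If N_i is the number
of common neighbours of a pair at exact level i, and N_{-1} = 0, the eigenvalues of A² are therefore
the tail sums θ_j = Σ_{i ≥ j} (N_i − N_{i−1}) s_i (`hasEigenvalue_chain_iff`). The eigenvectors for
θ_j are constant on E_j-classes with zero sums over E_{j−1}-classes; they exist because each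
refinement is strict.

For Um, write b ≡ u a mod π^t with u ≡ 1 mod π^s, where (s, t) runs through (0,0), (0,1), (1,1),
(1,2), ..., (ℓ,ℓ). At exact level (k, k+1), a common neighbour c would force u ≡ 1 mod π^(k+1), so
there is none. At exact level (k, k) with k < ℓ, b = a + π^k w with w independent of a mod π, and
the conditions a·c = 1 and π^k w·c = 0 have q^(ℓ(n−2)+k) solutions. Oddness of q enters through q >
2, which makes the step from (0,1) to (1,1) strict.

For Um₀ the levels are equality of points mod π^k. Solutions of a·c = b·c = 0 are counted in R^n,
those divisible by π are removed, and the rest is divided by |R^×|.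

All counts rest on the equal size of the fibres of a group homomorphism (`card_preimage_mul_card`)
and on |π^k R| = q^(ℓ−k) (`card_pow_dvd`). -/

open Classical in
/-- The `0`-`1` matrix of a relation. -/
noncomputable def relMatrix {V : Type*} (r : V → V → Prop) : Matrix V V ℂ :=
  Matrix.of fun a b => if r a b then 1 else 0

theorem relMatrix_mul_apply {V : Type*} [Fintype V] (r s : V → V → Prop) (a b : V) :
    (relMatrix r * relMatrix s) a b = (Nat.card {c // r a c ∧ s c b} : ℂ) := by
  classical
  simp only [Matrix.mul_apply, relMatrix, Matrix.of_apply, ← ite_and, mul_ite, mul_one, mul_zero,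
    Finset.sum_boole, Nat.card_eq_fintype_card, Fintype.card_subtype]
  congr 3
  ext c
  tauto

/-- The eigenvalues of a bipartite graph given by a symmetric relation are the square roots of the
eigenvalues of the square of the matrix of the relation. -/
theorem mem_adjacencyEigenvalues_bipartiteGraphOf {V : Type*} [Fintype V] [DecidableEq V]
    {r : V → V → Prop} (hr : ∀ a b, r a b → r b a) (z : ℂ) :
    z ∈ adjacencyEigenvalues (bipartiteGraphOf r) ↔
      Module.End.HasEigenvalue (Matrix.toLin' (relMatrix r * relMatrix r)) (z ^ 2) := by
  classical
  set A := relMatrix r with hA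
  have key : ∀ v : V ⊕ V → ℂ, ∀ w : V ⊕ V → ℂ,
      (∀ a, w a = ∑ b, (if (bipartiteGraphOf r).Adj a b then 1 else 0) * v b) ↔
      (w ∘ Sum.inl = A.mulVec (v ∘ Sum.inr) ∧ w ∘ Sum.inr = A.mulVec (v ∘ Sum.inl)) := by
    intro v w
    have hadj : ∀ a b, (if (bipartiteGraphOf r).Adj (Sum.inl a) (Sum.inr b) then (1 : ℂ) else 0) =
        A a b ∧ (if (bipartiteGraphOf r).Adj (Sum.inr a) (Sum.inl b) then (1 : ℂ) else 0) =
        A a b ∧ ¬ (bipartiteGraphOf r).Adj (Sum.inl a) (Sum.inl b) ∧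
        ¬ (bipartiteGraphOf r).Adj (Sum.inr a) (Sum.inr b) := by
      refine fun a b => ⟨?_, ?_, id, id⟩
      · by_cases h : r a b
        · refine (if_pos h).trans ?_; simp [hA, relMatrix, h]
        · refine (if_neg h).trans ?_; simp [hA, relMatrix, h]
      · by_cases h : r a b
        · refine (if_pos (hr _ _ h)).trans ?_; simp [hA, relMatrix, h]
        · refine (if_neg (fun h' => h (hr _ _ h'))).trans ?_; simp [hA, relMatrix, h]
    simp only [Sum.forall, Fintype.sum_sum_type, funext_iff, Matrix.mulVec, dotProduct,
      Function.comp, (hadj _ _).1, (hadj _ _).2.1, (hadj _ _).2.2.1, (hadj _ _).2.2.2, if_false,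
      zero_mul, Finset.sum_const_zero, zero_add, add_zero]
  have key2 : z ∈ adjacencyEigenvalues (bipartiteGraphOf r) ↔ ∃ x y : V → ℂ,
      (x ≠ 0 ∨ y ≠ 0) ∧ z • x = A.mulVec y ∧ z • y = A.mulVec x := by
    have h1 : z ∈ adjacencyEigenvalues (bipartiteGraphOf r) ↔ ∃ v : V ⊕ V → ℂ, v ≠ 0 ∧
        ∀ a, (z • v) a = ∑ b, (if (bipartiteGraphOf r).Adj a b then 1 else 0) * v b := by
      unfold adjacencyEigenvalues
      simp only [Set.mem_ofPred_eq]
      constructor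
      · intro h
        obtain ⟨v, hv⟩ := h.exists_hasEigenvector
        refine ⟨v, hv.2, fun a => ?_⟩
        have := congrFun hv.apply_eq_smul a
        rw [← this]
        simp only [Matrix.toLin'_apply, Matrix.mulVec, dotProduct, SimpleGraph.adjMatrix_apply]
        congr!
      · rintro ⟨v, hv, h⟩
        refine Module.End.hasEigenvalue_of_hasEigenvector (x := v) ?_
        rw [Module.End.hasEigenvector_iff, Module.End.mem_eigenspace_iff]
        refine ⟨?_, hv⟩
        funext a
        rw [h]
        simp only [Matrix.toLin'_apply, Matrix.mulVec, dotProduct, SimpleGraph.adjMatrix_apply]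
        congr!
    rw [h1]
    constructor
    · rintro ⟨v, hv, h⟩
      obtain ⟨h1, h2⟩ := (key v (z • v)).1 h
      refine ⟨v ∘ Sum.inl, v ∘ Sum.inr, ?_, h1, h2⟩
      by_contra! h0
      apply hv
      funext a
      rcases a with a | a
      · exact congrFun h0.1 a
      · exact congrFun h0.2 a
    · rintro ⟨x, y, hxy, h1, h2⟩
      refine ⟨Sum.elim x y, ?_, (key _ _).2 ⟨?_, ?_⟩⟩
      · intro h0
        rcases hxy with h | h
        · exact h (funext fun a => congrFun h0 (Sum.inl a))
        · exact h (funext fun a => congrFun h0 (Sum.inr a))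
      · exact h1
      · exact h2
  rw [key2]
  constructor
  · rintro ⟨x, y, hxy, h1, h2⟩
    have hx : (A * A).mulVec x = z ^ 2 • x := by
      rw [← Matrix.mulVec_mulVec, ← h2, Matrix.mulVec_smul, ← h1, smul_smul, sq]
    have hy : (A * A).mulVec y = z ^ 2 • y := by
      rw [← Matrix.mulVec_mulVec, ← h1, Matrix.mulVec_smul, ← h2, smul_smul, sq]
    rcases hxy with h | h
    · exact Module.End.hasEigenvalue_of_hasEigenvector (x := x)
        ⟨by rw [Module.End.mem_eigenspace_iff, Matrix.toLin'_apply, hx], h⟩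
    · exact Module.End.hasEigenvalue_of_hasEigenvector (x := y)
        ⟨by rw [Module.End.mem_eigenspace_iff, Matrix.toLin'_apply, hy], h⟩
  · intro h
    obtain ⟨x, hx⟩ := h.exists_hasEigenvector
    have hx1 : (A * A).mulVec x = z ^ 2 • x := by simpa using hx.apply_eq_smul
    have hx0 : x ≠ 0 := hx.2
    rw [← Matrix.mulVec_mulVec] at hx1
    -- If A²x = 0 then A kills x or the nonzero vector Ax. For z ≠ 0, pairing x with z⁻¹Ax solves
    -- the bipartite system.
    by_cases hz : z = 0
    · subst hz
      by_cases hAx : A.mulVec x = 0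
      · exact ⟨x, 0, Or.inl hx0, by simp, by simp [hAx]⟩
      · exact ⟨A.mulVec x, 0, Or.inl hAx, by simp, by simp [hx1]⟩
    · refine ⟨x, z⁻¹ • A.mulVec x, Or.inl hx0, ?_, ?_⟩
      · rw [Matrix.mulVec_smul, hx1, smul_smul, sq, inv_mul_cancel_left₀ hz]
      · rw [smul_smul, mul_inv_cancel₀ hz, one_smul]

/-! ### Spectra of matrices adapted to a chain of equivalence relations -/

section Chain

variable {V : Type*} {r : ℕ → Setoid V} {s : ℕ → ℕ}

/-- Every class of the coarse relation is a union of fine classes, so a path with one coarse and one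
fine step joins exactly the coarsely related pairs, and its midpoint ranges over one fine class. -/
theorem relMatrix_mul_of_le [Fintype V] {i j : ℕ} (h : r j ≤ r i)
    (hs : ∀ a, Nat.card {b // r j a b} = s j) :
    relMatrix (r i) * relMatrix (r j) = (s j : ℂ) • relMatrix (r i) ∧
    relMatrix (r j) * relMatrix (r i) = (s j : ℂ) • relMatrix (r i) := by
  classical
  constructor
  · ext a b
    rw [relMatrix_mul_apply, Matrix.smul_apply]
    by_cases hab : r i a b
    · rw [← hs b]
      simp only [relMatrix, Matrix.of_apply, hab, if_true, smul_eq_mul, mul_one, Nat.cast_inj]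
      refine Nat.card_congr (Equiv.subtypeEquivRight fun c => ?_)
      exact ⟨fun hc => (r j).symm hc.2,
        fun hc => ⟨(r i).trans hab (h hc), (r j).symm hc⟩⟩
    · have : IsEmpty {c // r i a c ∧ r j c b} :=
        ⟨fun c => hab ((r i).trans c.2.1 (h c.2.2))⟩
      simp [relMatrix, hab]
  · ext a b
    rw [relMatrix_mul_apply, Matrix.smul_apply]
    by_cases hab : r i a b
    · rw [← hs a]
      simp only [relMatrix, Matrix.of_apply, hab, if_true, smul_eq_mul, mul_one, Nat.cast_inj]
      refine Nat.card_congr (Equiv.subtypeEquivRight fun c => ?_)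
      exact ⟨fun hc => hc.1,
        fun hc => ⟨hc, (r i).trans ((r i).symm (h hc)) hab⟩⟩
    · have : IsEmpty {c // r j a c ∧ r i c b} :=
        ⟨fun c => hab ((r i).trans (h c.2.1) c.2.2)⟩
      simp [relMatrix, hab]

/-- A matrix whose entries depend only on the level in a chain of equivalence relations is a
combination of the matrices of these relations. -/
theorem eq_sum_relMatrix {m : ℕ} (hr : Antitone r) (h0 : r 0 = ⊤)
    {M : Matrix V V ℂ} {N c : ℕ → ℂ}
    (hM : ∀ i ≤ m, ∀ a b, r i a b → (i < m → ¬ r (i + 1) a b) → M a b = N i)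
    (hc : ∀ i, N i = ∑ j ∈ Finset.range (i + 1), c j) :
    M = ∑ i ∈ Finset.range (m + 1), c i • relMatrix (r i) := by
  classical
  ext a b
  have hex : ∃ i ≤ m, r i a b ∧ (i < m → ¬ r (i + 1) a b) := by
    -- The deepest level containing the pair; the entry there is the telescoping sum of the `c j`
    -- over all levels up to it.
    have hP : r (Nat.findGreatest (fun i => r i a b) m) a b :=
      Nat.findGreatest_spec (P := fun i => r i a b) (Nat.zero_le m) (by rw [h0]; trivial)
    exact ⟨_, Nat.findGreatest_le m, hP, fun hi =>
      Nat.findGreatest_is_greatest (P := fun i => r i a b) (Nat.lt_succ_self _) hi⟩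
  obtain ⟨i, hi, h1, h2⟩ := hex
  rw [hM i hi a b h1 h2, hc, Matrix.sum_apply]
  simp only [relMatrix, Matrix.smul_apply, Matrix.of_apply, smul_eq_mul, mul_ite, mul_one,
    mul_zero]
  rw [← Finset.sum_filter]
  congr 1
  ext j
  simp only [Finset.mem_range, Finset.mem_filter]
  constructor
  · intro hj
    exact ⟨by omega, hr (by omega : j ≤ i) h1⟩
  · rintro ⟨hj, hj'⟩
    by_contra hcon
    exact h2 (by omega) (hr (by omega : i + 1 ≤ j) hj')

/-- Terms coarser than level `j` absorb the level `j` matrix and contribute the factor `s j`. The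
remaining terms act on it by scalars `c i * s i`, and the recursion for `θ` says that these add up
to `θ j`. -/
theorem relMatrix_mul_sum [Fintype V] {m : ℕ} (hr : Antitone r)
    (hs : ∀ i ≤ m, ∀ a, Nat.card {b // r i a b} = s i) {c θ : ℕ → ℂ}
    (hθ : ∀ i ≤ m, θ i = θ (i + 1) + c i * s i) (hθm : θ (m + 1) = 0) {j : ℕ} (hj : j ≤ m) :
    (∑ i ∈ Finset.range (m + 1), c i • relMatrix (r i)) * relMatrix (r j) =
      (s j : ℂ) • (∑ i ∈ Finset.range j, c i • relMatrix (r i)) + θ j • relMatrix (r j) ∧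
    relMatrix (r j) * (∑ i ∈ Finset.range (m + 1), c i • relMatrix (r i)) =
      (s j : ℂ) • (∑ i ∈ Finset.range j, c i • relMatrix (r i)) + θ j • relMatrix (r j) := by
  have hθj : ∀ d, j + d = m + 1 → θ j = ∑ i ∈ Finset.range d, c (j + i) * s (j + i) := by
    have : ∀ d j, j + d = m + 1 → θ j = ∑ i ∈ Finset.range d, c (j + i) * s (j + i) := by
      intro d
      induction d with
      | zero => intro j hj; rw [show j = m + 1 by omega, hθm]; simp
      | succ d ih =>
        intro j hj
        rw [Finset.sum_range_succ', hθ j (by omega), ih (j + 1) (by omega)]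
        simp only [Nat.add_zero, add_assoc, add_comm 1]
    exact fun d => this d j
  obtain ⟨d, hd⟩ := Nat.exists_eq_add_of_le (show j ≤ m + 1 by omega)
  rw [hθj d hd.symm, hd, Finset.sum_range_add, Finset.sum_smul, Finset.smul_sum]
  rw [add_mul, mul_add, Finset.sum_mul, Finset.sum_mul, Finset.mul_sum, Finset.mul_sum]
  refine ⟨congrArg₂ _ (Finset.sum_congr rfl fun i hi => ?_)
    (Finset.sum_congr rfl fun i hi => ?_), congrArg₂ _ (Finset.sum_congr rfl fun i hi => ?_)
    (Finset.sum_congr rfl fun i hi => ?_)⟩ <;> rw [Finset.mem_range] at hi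
  · rw [Matrix.smul_mul, (relMatrix_mul_of_le (hr hi.le) (hs j hj)).1, smul_comm]
  · rw [Matrix.smul_mul, (relMatrix_mul_of_le (hr (Nat.le_add_right j i))
      (hs (j + i) (by omega))).2, smul_smul]
  · rw [Matrix.mul_smul, (relMatrix_mul_of_le (hr hi.le) (hs j hj)).2, smul_comm]
  · rw [Matrix.mul_smul, (relMatrix_mul_of_le (hr (Nat.le_add_right j i))
      (hs (j + i) (by omega))).1, smul_smul]

/-- The eigenvalues of a matrix whose entries depend only on the level in a strictly decreasing
chain of equivalence relations with classes of constant size. -/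
theorem hasEigenvalue_chain_iff [Fintype V] [DecidableEq V] [Nonempty V] {m : ℕ} (hr : Antitone r)
    (h0 : r 0 = ⊤) (hm : r m = ⊥) (hs : ∀ i ≤ m, ∀ a, Nat.card {b // r i a b} = s i)
    (hlt : ∀ i < m, s (i + 1) < s i) {M : Matrix V V ℂ} {N θ : ℕ → ℂ}
    (hM : ∀ i ≤ m, ∀ a b, r i a b → (i < m → ¬ r (i + 1) a b) → M a b = N i)
    (hθ0 : θ 0 = θ 1 + N 0 * s 0)
    (hθ : ∀ i < m, θ (i + 1) = θ (i + 2) + (N (i + 1) - N i) * s (i + 1))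
    (hθm : θ (m + 1) = 0) (z : ℂ) :
    Module.End.HasEigenvalue (Matrix.toLin' M) z ↔ ∃ i ≤ m, z = θ i := by
  -- Successive differences of `N`, with `N (-1)` read as 0; the case split guards against truncated
  -- subtraction.
  let c : ℕ → ℂ := fun i => N i - if i = 0 then 0 else N (i - 1)
  have hc : ∀ i, N i = ∑ j ∈ Finset.range (i + 1), c j := by
    intro i
    induction i with
    | zero => simp [c]
    | succ i ih => rw [Finset.sum_range_succ, ← ih]; simp [c]
  have hMc := eq_sum_relMatrix hr h0 hM hc
  have hθc : ∀ i ≤ m, θ i = θ (i + 1) + c i * s i := by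
    intro i hi
    cases i with
    | zero => simpa [c] using hθ0
    | succ i => simpa [c] using hθ i hi
  have hmul := fun j (hj : j ≤ m) => relMatrix_mul_sum hr hs hθc hθm hj
  rw [← hMc] at hmul
  constructor
  · intro hz
    obtain ⟨x, hx⟩ := hz.exists_hasEigenvector
    have hx1 : M.mulVec x = z • x := by simpa using hx.apply_eq_smul
    have hx0 : x ≠ 0 := hx.2
    -- An eigenvector is tested at the least level that does not kill it: there all coarser terms of
    -- the product vanish and only `θ j` survives. Level `m` qualifies, being the identity matrix.
    have hex : ∃ j, j ≤ m ∧ (relMatrix (r j)).mulVec x ≠ 0 := by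
      refine ⟨m, le_rfl, ?_⟩
      have : relMatrix (r m) = 1 := by
        rw [hm]
        ext a b
        simp [relMatrix, Matrix.one_apply]
      rwa [this, Matrix.one_mulVec]
    classical
    obtain ⟨hjm, hj⟩ := Nat.find_spec hex
    have hlow : ∀ i < Nat.find hex, (relMatrix (r i)).mulVec x = 0 := by
      intro i hi
      have := Nat.find_min hex hi
      by_contra h
      exact this ⟨by omega, h⟩
    set j := Nat.find hex
    refine ⟨j, hjm, ?_⟩
    have h1 := congrArg (fun B => B.mulVec x) (hmul j hjm).2
    simp only [← Matrix.mulVec_mulVec, hx1, Matrix.add_mulVec, Matrix.smul_mulVec,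
      Matrix.sum_mulVec, Matrix.mulVec_smul] at h1
    rw [Finset.sum_eq_zero, smul_zero, zero_add] at h1
    · exact smul_left_injective ℂ hj h1
    · intro i hi
      rw [hlow i (Finset.mem_range.1 hi), smul_zero]
  · rintro ⟨j, hj, rfl⟩
    have hgood : ∃ y : V → ℂ, (relMatrix (r j)).mulVec y ≠ 0 ∧
        ∀ i < j, (relMatrix (r i)).mulVec y = 0 := by
      cases j with
      | zero =>
        obtain ⟨a⟩ := ‹Nonempty V›
        refine ⟨Pi.single a 1, fun h => ?_, by simp⟩
        have := congrFun h a
        simp [relMatrix] at this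
      | succ j =>
        obtain ⟨a⟩ := ‹Nonempty V›
        -- Class sizes drop strictly, so some pair separates exactly at level `j + 1`. The
        -- difference of its point masses sums to zero over every coarser class, but not over the
        -- class of `a` at level `j + 1`.
        have : ∃ b, r j a b ∧ ¬ r (j + 1) a b := by
          by_contra! hcon
          have := Nat.card_congr (Equiv.subtypeEquivRight fun b =>
            (⟨hcon b, fun h => hr (Nat.le_succ j) h⟩ : r j a b ↔ r (j + 1) a b))
          rw [hs j (by omega), hs (j + 1) hj] at this
          have := hlt j hj
          omega
        obtain ⟨b, hab, hab'⟩ := this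
        refine ⟨Pi.single a 1 - Pi.single b 1, fun h => ?_, fun i hi => ?_⟩
        · have := congrFun h a
          simp [relMatrix, Matrix.mulVec_sub, hab'] at this
        · funext d
          have h1 : r i a b := hr (by omega : i ≤ j) hab
          have h2 : r i d a ↔ r i d b :=
            ⟨fun h => (r i).trans h h1, fun h => (r i).trans h ((r i).symm h1)⟩
          by_cases h3 : r i d b <;> simp [relMatrix, Matrix.mulVec_sub, h2, h3]
    obtain ⟨y, hy, hlow⟩ := hgood
    refine Module.End.hasEigenvalue_of_hasEigenvector (x := (relMatrix (r j)).mulVec y) ⟨?_, hy⟩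
    rw [Module.End.mem_eigenspace_iff, Matrix.toLin'_apply, Matrix.mulVec_mulVec, (hmul j hj).1,
      Matrix.add_mulVec, Matrix.smul_mulVec, Matrix.smul_mulVec, Matrix.sum_mulVec,
      Finset.sum_eq_zero, smul_zero, zero_add]
    intro i hi
    rw [Matrix.smul_mulVec, hlow i (Finset.mem_range.1 hi), smul_zero]

end Chain

/-! ### Counting through homomorphisms of finite groups -/

theorem card_subtype_add_card_not {α : Type*} [Finite α] (P : α → Prop) :
    Nat.card {x // P x} + Nat.card {x // ¬ P x} = Nat.card α := by
  classical
  rw [← Nat.card_sum, Nat.card_congr (Equiv.sumCompl P)]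

/-- The preimage of a set under a surjective homomorphism of finite groups has the expected
size. -/
theorem card_preimage_mul_card {G H : Type*} [AddCommGroup G] [AddCommGroup H] [Finite G]
    [Finite H] (f : G →+ H) (hf : Function.Surjective f) (P : H → Prop) :
    Nat.card {x // P (f x)} * Nat.card H = Nat.card {y // P y} * Nat.card G := by
  have hfib : ∀ y, Nat.card {x // f x = y} = Nat.card f.ker := by
    intro y
    obtain ⟨x₀, rfl⟩ := hf y
    exact Nat.card_congr
      { toFun := fun x => ⟨x.1 - x₀, by simp [AddMonoidHom.mem_ker, x.2]⟩
        invFun := fun k => ⟨k.1 + x₀, by simp [(AddMonoidHom.mem_ker).1 k.2]⟩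
        left_inv := fun x => by simp
        right_inv := fun k => by simp }
  have key : ∀ Q : H → Prop, Nat.card {x // Q (f x)} = Nat.card {y // Q y} * Nat.card f.ker := by
    intro Q
    classical
    have := Fintype.ofFinite H
    have hQ : ∀ y : {y // Q y}, Nat.card {x : {x // Q (f x)} // (⟨f x.1, x.2⟩ : {y // Q y}) = y} =
        Nat.card f.ker := by
      rintro ⟨y, hy⟩
      rw [← hfib y]
      exact Nat.card_congr
        { toFun := fun x => ⟨x.1.1, congrArg Subtype.val x.2⟩
          invFun := fun x => ⟨⟨x.1, by rw [x.2]; exact hy⟩, Subtype.ext x.2⟩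
          left_inv := fun x => rfl
          right_inv := fun x => rfl }
    rw [Nat.card_congr (Equiv.sigmaFiberEquiv (fun x : {x // Q (f x)} =>
      (⟨f x.1, x.2⟩ : {y // Q y}))).symm, Nat.card_sigma, Finset.sum_congr rfl fun y _ => hQ y,
      Finset.sum_const, smul_eq_mul, Finset.card_univ, Nat.card_eq_fintype_card (α := {y // Q y})]
  -- Comparison with the always-true predicate eliminates the size of the kernel.
  have h1 := key P
  have h2 := key fun _ => True
  have h3 : Nat.card {x : G // True} = Nat.card G := Nat.card_congr (Equiv.subtypeUnivEquiv fun _ => trivial)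
  have h4 : Nat.card {x : H // True} = Nat.card H := Nat.card_congr (Equiv.subtypeUnivEquiv fun _ => trivial)
  rw [h3, h4] at h2
  rw [h1, h2]
  ring

theorem nilpotencyClass_le_of_pow_eq_zero {R : Type*} [MonoidWithZero R] {π : R} {k : ℕ} (h : π ^ k = 0) : nilpotencyClass π ≤ k :=
  Nat.sInf_le h

theorem card_dvd_mul_card_annihilator {R : Type*} [CommRing R] [Finite R] (π : R) (k : ℕ) :
    Nat.card {x : R // π ^ k ∣ x} * Nat.card {t : R // π ^ k * t = 0} = Nat.card R := by
  have := card_preimage_mul_card (AddMonoidHom.mulLeft (π ^ k)).rangeRestrict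
    (AddMonoidHom.rangeRestrict_surjective _) (fun y => y = 0)
  simp only [Nat.card_unique, one_mul] at this
  rw [← this, mul_comm]
  congr 1
  · refine Nat.card_congr (Equiv.subtypeEquivRight fun x => ?_)
    rw [Subtype.ext_iff]
    rfl
  · refine Nat.card_congr (Equiv.subtypeEquivRight fun x => ?_)
    exact ⟨fun ⟨y, hy⟩ => ⟨y, hy.symm⟩, fun ⟨y, hy⟩ => ⟨y, hy.symm⟩⟩

/-! ### Ideals, annihilators and units of a finite chain ring -/

section ChainRing

open IsLocalRing

variable {R : Type*} [CommRing R] [IsLocalRing R] {π : R}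

theorem isUnit_iff_not_dvd (hπ : maximalIdeal R = Ideal.span {π}) {x : R} :
    IsUnit x ↔ ¬ π ∣ x := by
  rw [← Ideal.mem_span_singleton, ← hπ, mem_maximalIdeal, mem_nonunits_iff, not_not]

theorem residue_eq_zero_iff_dvd (hπ : maximalIdeal R = Ideal.span {π}) {x : R} :
    residue R x = 0 ↔ π ∣ x := by
  rw [residue_eq_zero_iff, hπ, Ideal.mem_span_singleton]

variable [Finite R]

theorem isNilpotent_uniformizer (hπ : maximalIdeal R = Ideal.span {π}) : IsNilpotent π := by
  obtain ⟨n, hn⟩ := IsArtinianRing.isNilpotent_jacobson_bot (R := R)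
  refine ⟨n, ?_⟩
  rw [IsLocalRing.jacobson_eq_maximalIdeal _ bot_ne_top, hπ, Ideal.span_singleton_pow] at hn
  simpa using hn

theorem pow_nilpotencyClass_uniformizer (hπ : maximalIdeal R = Ideal.span {π}) :
    π ^ nilpotencyClass π = 0 :=
  pow_nilpotencyClass (isNilpotent_uniformizer hπ)

theorem nilpotencyClass_uniformizer_pos (hπ : maximalIdeal R = Ideal.span {π}) :
    0 < nilpotencyClass π :=
  pos_nilpotencyClass_iff.2 (isNilpotent_uniformizer hπ)

theorem exists_eq_pow_mul_unit (hπ : maximalIdeal R = Ideal.span {π}) {x : R} (hx : x ≠ 0) :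
    ∃ (j : ℕ) (u : Rˣ), x = π ^ j * u := by
  classical
  have h0 : ¬ π ^ nilpotencyClass π ∣ x := by
    rw [pow_nilpotencyClass_uniformizer hπ, zero_dvd_iff]
    exact hx
  have hex : ∃ j, ¬ π ^ j ∣ x := ⟨_, h0⟩
  have hj := Nat.find_spec hex
  have hlt := fun k => Nat.find_min hex (m := k)
  rcases hcase : Nat.find hex with _ | j
  · rw [hcase] at hj
    simp at hj
  · rw [hcase] at hj hlt
    obtain ⟨y, hy⟩ := not_not.1 (hlt j (Nat.lt_succ_self j))
    have : IsUnit y := by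
      rw [isUnit_iff_not_dvd hπ]
      rintro ⟨w, rfl⟩
      exact hj ⟨w, by rw [hy]; ring⟩
    exact ⟨j, this.unit, hy⟩

theorem pow_mul_eq_zero_iff (hπ : maximalIdeal R = Ideal.span {π}) {k : ℕ}
    (hk : k ≤ nilpotencyClass π) {t : R} :
    π ^ k * t = 0 ↔ π ^ (nilpotencyClass π - k) ∣ t := by
  constructor
  · intro h
    by_cases ht : t = 0
    · rw [ht]; exact dvd_zero _
    · obtain ⟨j, u, rfl⟩ := exists_eq_pow_mul_unit hπ ht
      rw [← mul_assoc, Units.mul_left_eq_zero, ← pow_add] at h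
      have := nilpotencyClass_le_of_pow_eq_zero h
      exact (pow_dvd_pow π (by omega)).mul_right _
  · rintro ⟨w, rfl⟩
    rw [← mul_assoc, ← pow_add, Nat.add_sub_cancel' hk, pow_nilpotencyClass_uniformizer hπ,
      zero_mul]

theorem card_residueField_mul_card_dvd (hπ : maximalIdeal R = Ideal.span {π}) :
    Nat.card {x : R // π ∣ x} * Nat.card (ResidueField R) = Nat.card R := by
  have : Finite (ResidueField R) := Finite.of_surjective _ residue_surjective
  have := card_preimage_mul_card (residue R).toAddMonoidHom residue_surjective (fun y => y = 0)
  simp only [Nat.card_unique, one_mul] at this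
  rw [← this]
  congr 1
  refine Nat.card_congr (Equiv.subtypeEquivRight fun x => ?_)
  exact (residue_eq_zero_iff_dvd hπ).symm

/-- Multiplication by π and the residue map give |πR|·|ann π| = |R| = |πR|·q. -/
theorem card_annihilator_uniformizer (hπ : maximalIdeal R = Ideal.span {π}) :
    Nat.card {t : R // π * t = 0} = Nat.card (ResidueField R) := by
  have h1 := card_dvd_mul_card_annihilator π 1
  rw [← card_residueField_mul_card_dvd hπ] at h1
  simp only [pow_one] at h1
  have : Nonempty {x : R // π ∣ x} := ⟨⟨0, dvd_zero _⟩⟩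
  exact Nat.eq_of_mul_eq_mul_left Nat.card_pos h1

/-- Multiplication by π maps π^k R onto π^(k+1) R. Its kernel is all of ann π, since ann π = π^(ℓ−1)
R lies in π^k R for k < ℓ. -/
theorem card_pow_dvd_succ (hπ : maximalIdeal R = Ideal.span {π}) {k : ℕ}
    (hk : k < nilpotencyClass π) :
    Nat.card {x : R // π ^ k ∣ x} =
      Nat.card (ResidueField R) * Nat.card {x : R // π ^ (k + 1) ∣ x} := by
  let S : AddSubgroup R := (Ideal.span {π ^ k}).toAddSubgroup
  have hS : ∀ x, x ∈ S ↔ π ^ k ∣ x := fun x => Ideal.mem_span_singleton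
  let f : S →+ R := (AddMonoidHom.mulLeft π).comp S.subtype
  have h := card_preimage_mul_card f.rangeRestrict (AddMonoidHom.rangeRestrict_surjective _)
    (fun y => y = 0)
  simp only [Nat.card_unique, one_mul] at h
  have e1 : Nat.card S = Nat.card {x : R // π ^ k ∣ x} :=
    Nat.card_congr (Equiv.subtypeEquivRight hS)
  have e2 : Nat.card f.range = Nat.card {x : R // π ^ (k + 1) ∣ x} := by
    refine Nat.card_congr (Equiv.subtypeEquivRight fun x => ?_)
    constructor
    · rintro ⟨⟨y, hy⟩, rfl⟩
      obtain ⟨w, rfl⟩ := (hS y).1 hy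
      exact ⟨w, by change π * (π ^ k * w) = _; ring⟩
    · rintro ⟨w, rfl⟩
      exact ⟨⟨π ^ k * w, (hS _).2 (dvd_mul_right _ _)⟩, by
        change π * (π ^ k * w) = _; ring⟩
  have e3 : Nat.card {x : S // f.rangeRestrict x = 0} = Nat.card (ResidueField R) := by
    rw [← card_annihilator_uniformizer hπ]
    have hz : ∀ x : S, f.rangeRestrict x = 0 ↔ π * x.1 = 0 := fun x => by
      rw [Subtype.ext_iff]; rfl
    refine Nat.card_congr
      { toFun := fun x => ⟨x.1.1, (hz _).1 x.2⟩
        invFun := fun t => ⟨⟨t.1, (hS _).2 ?_⟩, (hz _).2 t.2⟩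
        left_inv := fun x => rfl
        right_inv := fun x => rfl }
    have ht : π ^ 1 * t.1 = 0 := by rw [pow_one]; exact t.2
    rw [pow_mul_eq_zero_iff hπ (by omega)] at ht
    exact (pow_dvd_pow π (by omega)).trans ht
  rw [← e1, ← h, e2, e3]

theorem card_pow_dvd (hπ : maximalIdeal R = Ideal.span {π}) {k : ℕ}
    (hk : k ≤ nilpotencyClass π) :
    Nat.card {x : R // π ^ k ∣ x} = Nat.card (ResidueField R) ^ (nilpotencyClass π - k) := by
  obtain ⟨d, hd⟩ := Nat.exists_eq_add_of_le hk
  rw [hd, Nat.add_sub_cancel_left]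
  induction d generalizing k with
  | zero =>
    rw [← Nat.add_zero k, ← hd, pow_nilpotencyClass_uniformizer hπ]
    simp
  | succ d ih => rw [card_pow_dvd_succ hπ (by omega), ih (by omega) (by omega), pow_succ']

theorem card_eq_card_residueField_pow (hπ : maximalIdeal R = Ideal.span {π}) :
    Nat.card R = Nat.card (ResidueField R) ^ nilpotencyClass π := by
  have := card_pow_dvd hπ (Nat.zero_le _)
  simp only [pow_zero, isUnit_one.dvd, Nat.sub_zero] at this
  rw [← this]
  exact (Nat.card_congr (Equiv.subtypeUnivEquiv fun _ => trivial)).symm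

theorem card_annihilator_pow (hπ : maximalIdeal R = Ideal.span {π}) {k : ℕ}
    (hk : k ≤ nilpotencyClass π) :
    Nat.card {t : R // π ^ k * t = 0} = Nat.card (ResidueField R) ^ k := by
  rw [Nat.card_congr (Equiv.subtypeEquivRight fun t => pow_mul_eq_zero_iff hπ hk),
    card_pow_dvd hπ (by omega), Nat.sub_sub_self hk]

theorem card_units_add (hπ : maximalIdeal R = Ideal.span {π}) :
    Nat.card Rˣ + Nat.card (ResidueField R) ^ (nilpotencyClass π - 1) =
      Nat.card (ResidueField R) ^ nilpotencyClass π := by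
  rw [← card_eq_card_residueField_pow hπ,
    ← card_pow_dvd hπ (nilpotencyClass_uniformizer_pos hπ), pow_one,
    ← card_subtype_add_card_not (fun x : R => π ∣ x), add_comm]
  congr 1
  exact (Nat.card_congr (Submonoid.unitsTypeEquivIsUnitSubmonoid (M := R)).toEquiv).trans
    (Nat.card_congr (Equiv.subtypeEquivRight fun x => isUnit_iff_not_dvd hπ))

theorem isField_iff_nilpotencyClass (hπ : maximalIdeal R = Ideal.span {π}) :
    IsField R ↔ nilpotencyClass π = 1 := by
  rw [IsLocalRing.isField_iff_maximalIdeal_eq, hπ, Ideal.span_singleton_eq_bot]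
  have hpos := nilpotencyClass_uniformizer_pos hπ
  constructor
  · intro h
    have := nilpotencyClass_le_of_pow_eq_zero (π := π) (k := 1) (by simpa using h)
    omega
  · intro h
    simpa [h] using pow_nilpotencyClass_uniformizer hπ

end ChainRing

/-! ### Linear equations and congruences on tuples -/

section Tuple

open IsLocalRing

theorem card_dotProduct {R : Type*} [CommRing R] [Finite R] {n : ℕ} {a e : Fin n → R}
    (he : dotProduct a e = 1) (P : R → Prop) :
    Nat.card {c : Fin n → R // P (dotProduct a c)} * Nat.card R =
      Nat.card {y // P y} * Nat.card R ^ n := by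
  let f : (Fin n → R) →+ R :=
    { toFun := dotProduct a
      map_zero' := dotProduct_zero a
      map_add' := dotProduct_add a }
  have hf : Function.Surjective f := fun s => ⟨s • e, by
    change dotProduct a (s • e) = s
    rw [dotProduct_smul, he, smul_eq_mul, mul_one]⟩
  have := card_preimage_mul_card f hf P
  rwa [Nat.card_fun, Nat.card_eq_fintype_card (α := Fin n), Fintype.card_fin] at this

/-- The vectors `d` and `e` make c ↦ (a·c, w·c) surjective onto R × R, so two linear conditions are
counted as independent ones. -/
theorem card_dotProduct_pair {R : Type*} [CommRing R] [Finite R] {n : ℕ} {a w d e : Fin n → R}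
    (he : dotProduct a e = 1) (hd : dotProduct a d = 0) (hw : dotProduct w d = 1)
    (P : R × R → Prop) :
    Nat.card {c : Fin n → R // P (dotProduct a c, dotProduct w c)} * (Nat.card R * Nat.card R) =
      Nat.card {y // P y} * Nat.card R ^ n := by
  let f : (Fin n → R) →+ R × R :=
    { toFun := fun c => (dotProduct a c, dotProduct w c)
      map_zero' := by simp
      map_add' := fun x y => by simp [dotProduct_add] }
  have hf : Function.Surjective f := fun s => ⟨s.1 • e + (s.2 - s.1 * dotProduct w e) • d, by
    change (dotProduct a _, dotProduct w _) = s
    simp [dotProduct_add, dotProduct_smul, he, hd, hw]⟩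
  have := card_preimage_mul_card f hf P
  rwa [Nat.card_prod, Nat.card_fun, Nat.card_eq_fintype_card (α := Fin n), Fintype.card_fin]
    at this

theorem dvd_of_forall_dvd_mul {R : Type*} [CommRing R] {n : ℕ} {a : Fin n → R}
    (ha : ∃ i, IsUnit (a i)) {x v : R} (h : ∀ j, x ∣ v * a j) : x ∣ v := by
  obtain ⟨i, hi⟩ := ha
  exact (hi.dvd_mul_right).1 (h i)

theorem exists_dotProduct_eq_one {R : Type*} [CommRing R] {n : ℕ} {a : Fin n → R}
    (ha : ∃ i, IsUnit (a i)) : ∃ e, dotProduct a e = 1 := by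
  obtain ⟨i, hi⟩ := ha
  exact ⟨Pi.single i ↑hi.unit⁻¹, by simp⟩

variable {R : Type*} [CommRing R] [IsLocalRing R] {π : R} {n : ℕ}

theorem span_range_eq_top_iff {a : Fin n → R} :
    Ideal.span (Set.range a) = ⊤ ↔ ∃ i, IsUnit (a i) := by
  constructor
  · intro h
    by_contra! hcon
    have hle : Ideal.span (Set.range a) ≤ maximalIdeal R := by
      rw [Ideal.span_le]
      rintro _ ⟨i, rfl⟩
      exact (mem_maximalIdeal _).2 (hcon i)
    rw [h, top_le_iff] at hle
    exact Ideal.IsPrime.ne_top' hle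
  · rintro ⟨i, hi⟩
    exact Ideal.eq_top_of_isUnit_mem _ (Ideal.subset_span ⟨i, rfl⟩) hi

theorem exists_isUnit_iff (hπ : maximalIdeal R = Ideal.span {π}) {a : Fin n → R} :
    (∃ i, IsUnit (a i)) ↔ ¬ ∀ i, π ∣ a i := by
  simp only [isUnit_iff_not_dvd hπ, not_forall]

theorem exists_dual_pair (hπ : maximalIdeal R = Ideal.span {π}) {a w : Fin n → R}
    (ha : ∃ i, IsUnit (a i)) (hw : ∀ v, ∃ j, ¬ π ∣ w j - v * a j) :
    ∃ d e, dotProduct a e = 1 ∧ dotProduct a d = 0 ∧ dotProduct w d = 1 := by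
  obtain ⟨e, he⟩ := exists_dotProduct_eq_one ha
  obtain ⟨i, hi⟩ := ha
  set b : R := ↑hi.unit⁻¹ with hb
  have hab : a i * b = 1 := by simp [hb]
  -- With v = w_i / a_i the entry w_j − v a_j is a unit, which amounts to an invertible 2×2 minor of
  -- (a, w). Then `d` is e_j − (a_j / a_i) e_i divided by that unit.
  obtain ⟨j, hj⟩ := hw (w i * b)
  rw [← isUnit_iff_not_dvd hπ] at hj
  refine ⟨(↑hj.unit⁻¹ : R) • (Pi.single j 1 - (a j * b) • Pi.single i 1), e, he, ?_, ?_⟩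
  · simp only [dotProduct_smul, dotProduct_sub, dotProduct_single, smul_eq_mul]
    linear_combination (-(↑hj.unit⁻¹ : R) * a j) * hab
  · simp only [dotProduct_smul, dotProduct_sub, dotProduct_single, smul_eq_mul]
    linear_combination hj.val_inv_mul

variable [Finite R]

/-- The map c ↦ πc has image the tuples divisible by π and kernel (ann π)^n, of size q^n. -/
theorem card_dvd_tuple (hπ : maximalIdeal R = Ideal.span {π}) (P : (Fin n → R) → Prop) :
    Nat.card {c : Fin n → R // P c ∧ ∀ i, π ∣ c i} * Nat.card (ResidueField R) ^ n =
      Nat.card {c : Fin n → R // P (π • c)} := by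
  let f : (Fin n → R) →+ (Fin n → R) := DistribSMul.toAddMonoidHom _ π
  have hker : Nat.card {c // f.rangeRestrict c = 0} = Nat.card (ResidueField R) ^ n := by
    rw [← card_annihilator_uniformizer hπ]
    have hz : ∀ x : Fin n → R, f.rangeRestrict x = 0 ↔ ∀ i, π * x i = 0 := fun x => by
      rw [Subtype.ext_iff, funext_iff]; rfl
    rw [Nat.card_congr (Equiv.subtypeEquivRight hz),
      Nat.card_congr (Equiv.subtypePiEquivPi (p := fun _ x => π * x = 0)), Nat.card_pi]
    simp
  have h1 := card_preimage_mul_card f.rangeRestrict (AddMonoidHom.rangeRestrict_surjective _)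
    (fun y => P y.1)
  have h2 := card_preimage_mul_card f.rangeRestrict (AddMonoidHom.rangeRestrict_surjective _)
    (fun y => y = 0)
  simp only [Nat.card_unique, one_mul] at h2
  rw [hker] at h2
  have h3 : Nat.card {y : f.range // P y.1} = Nat.card {c : Fin n → R // P c ∧ ∀ i, π ∣ c i} := by
    have hmem : ∀ c, c ∈ f.range ↔ ∀ i, π ∣ c i := by
      intro c
      constructor
      · rintro ⟨x, rfl⟩ i
        exact ⟨x i, rfl⟩
      · intro h
        choose x hx using h
        exact ⟨x, funext fun i => (hx i).symm⟩
    refine (Nat.card_congr (Equiv.subtypeSubtypeEquivSubtypeInter (· ∈ f.range) P)).trans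
      (Nat.card_congr (Equiv.subtypeEquivRight fun c => ?_))
    rw [hmem, and_comm]
  rw [← h3]
  refine Nat.eq_of_mul_eq_mul_right (Nat.card_pos (α := f.range)) ?_
  rw [mul_assoc, h2, ← h1]
  rfl

theorem card_tuple_near_line (hπ : maximalIdeal R = Ideal.span {π}) {a : Fin n → R}
    (ha : ∃ i, IsUnit (a i)) {s t : ℕ} (hst : s ≤ t) (ht : t ≤ nilpotencyClass π) :
    Nat.card {b : Fin n → R // ∃ u, π ^ s ∣ u ∧ ∀ j, π ^ t ∣ b j - u * a j} =
      Nat.card (ResidueField R) ^ (nilpotencyClass π - s) *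
        (Nat.card (ResidueField R) ^ (nilpotencyClass π - t)) ^ (n - 1) := by
  obtain ⟨i, hi⟩ := ha
  set a' : R := ↑hi.unit⁻¹ with ha'
  have haa : a i * a' = 1 := by simp [ha']
  -- A shear along `a` with the unit entry a_i as pivot. It turns the neighbourhood of the line into
  -- a box: coordinate i in π^s R, the others in π^t R.
  let φ : (Fin n → R) ≃ (Fin n → R) :=
    { toFun := fun b j => if j = i then b i else b j - b i * a' * a j
      invFun := fun b j => if j = i then b i else b j + b i * a' * a j
      left_inv := fun b => by
        funext j
        by_cases h : j = i <;> simp [h]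
      right_inv := fun b => by
        funext j
        by_cases h : j = i <;> simp [h] }
  have key : ∀ b : Fin n → R, (∃ u, π ^ s ∣ u ∧ ∀ j, π ^ t ∣ b j - u * a j) ↔
      ∀ j, (if j = i then π ^ s else π ^ t) ∣ φ b j := by
    intro b
    have hst' : π ^ s ∣ π ^ t := pow_dvd_pow π hst
    constructor
    · rintro ⟨u, hu, h⟩ j
      by_cases hj : j = i
      · subst hj
        simp only [φ, Equiv.coe_fn_mk, if_true]
        have := dvd_add (hst'.trans (h j)) (hu.mul_right (a j))
        rwa [sub_add_cancel] at this
      · simp only [φ, Equiv.coe_fn_mk, if_neg hj]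
        have := dvd_sub (h j) ((h i).mul_right (a' * a j))
        refine this.trans (dvd_of_eq ?_)
        linear_combination (u * a j) * haa
    · intro h
      refine ⟨b i * a', ?_, fun j => ?_⟩
      · have := h i
        simp only [φ, Equiv.coe_fn_mk, if_true] at this
        exact this.mul_right _
      · by_cases hj : j = i
        · subst hj
          rw [show b j - b j * a' * a j = 0 by linear_combination (-b j) * haa]
          exact dvd_zero _
        · have := h j
          simpa only [φ, Equiv.coe_fn_mk, if_neg hj] using this
  have e1 : Nat.card {b : Fin n → R // ∃ u, π ^ s ∣ u ∧ ∀ j, π ^ t ∣ b j - u * a j} =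
      Nat.card {y : Fin n → R // ∀ j, (if j = i then π ^ s else π ^ t) ∣ y j} :=
    Nat.card_congr (φ.subtypeEquiv key)
  rw [e1, Nat.card_congr (Equiv.subtypePiEquivPi
    (p := fun j x => (if j = i then π ^ s else π ^ t) ∣ x)), Nat.card_pi,
    Fintype.prod_eq_mul_prod_compl i, if_pos rfl, card_pow_dvd hπ (hst.trans ht)]
  congr 1
  rw [Finset.prod_congr rfl (g := fun _ => Nat.card {x : R // π ^ t ∣ x}), Finset.prod_const,
    Finset.card_compl, Finset.card_singleton, Fintype.card_fin, card_pow_dvd hπ ht]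
  intro j hj
  rw [if_neg (by simpa using hj)]

end Tuple

/-! ### The congruence relations and their class sizes -/

/-- Two unimodular tuples are related if, modulo `π ^ t`, they differ by a unit that is `1` modulo
`π ^ s`. -/
def scalingSetoid {R : Type*} [CommRing R] (π : R) (n s t : ℕ) : Setoid (UnimodularTuple R n) where
  r a b := ∃ u : Rˣ, π ^ s ∣ (u : R) - 1 ∧ ∀ j, π ^ t ∣ b.1 j - u * a.1 j
  iseqv :=
    { refl := fun a => ⟨1, by simp, by simp⟩
      symm := by
        rintro a b ⟨u, hu, h⟩
        refine ⟨u⁻¹, (hu.mul_right (-(↑u⁻¹ : R))).trans (dvd_of_eq ?_),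
          fun j => ((h j).mul_right (-(↑u⁻¹ : R))).trans (dvd_of_eq ?_)⟩
        · linear_combination (-1 : R) * u.mul_inv
        · linear_combination (a.1 j) * u.mul_inv
      trans := by
        rintro a b c ⟨u, hu, h⟩ ⟨v, hv, h'⟩
        refine ⟨v * u, ?_, fun j => ?_⟩
        · refine (dvd_add (hu.mul_left (v : R)) hv).trans (dvd_of_eq ?_)
          push_cast
          ring
        · refine (dvd_add ((h j).mul_left (v : R)) (h' j)).trans (dvd_of_eq ?_)
          push_cast
          ring }

theorem scalingSetoid_mono {R : Type*} [CommRing R] {π : R} {n s t s' t' : ℕ} (hs : s ≤ s')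
    (ht : t ≤ t') : scalingSetoid π n s' t' ≤ scalingSetoid π n s t := by
  rintro a b ⟨u, hu, h⟩
  exact ⟨u, (pow_dvd_pow π hs).trans hu, fun j => (pow_dvd_pow π ht).trans (h j)⟩

theorem scalingSetoid_zero_zero {R : Type*} [CommRing R] {π : R} {n : ℕ} :
    scalingSetoid π n 0 0 = ⊤ :=
  top_le_iff.1 fun _ _ _ => ⟨1, by simp, by simp⟩

theorem scalingSetoid_eq_bot {R : Type*} [CommRing R] {π : R} {n k : ℕ} (hk : π ^ k = 0) :
    scalingSetoid π n k k = ⊥ := by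
  refine le_bot_iff.1 ?_
  rintro a b ⟨u, hu, h⟩
  rw [hk, zero_dvd_iff, sub_eq_zero] at hu
  refine Subtype.ext (funext fun j => ?_)
  have := h j
  rw [hk, zero_dvd_iff, hu, one_mul, sub_eq_zero] at this
  exact this.symm

section Classes

open IsLocalRing

variable {R : Type*} [CommRing R] [IsLocalRing R] {π : R} {n : ℕ}

theorem UnimodularTuple.exists_isUnit (a : UnimodularTuple R n) : ∃ i, IsUnit (a.1 i) :=
  span_range_eq_top_iff.1 a.2

theorem isUnit_of_forall_dvd_sub (hπ : maximalIdeal R = Ideal.span {π}) {t : ℕ} (ht : 1 ≤ t)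
    {b a : Fin n → R} (hb : ∃ i, IsUnit (b i)) {u : R} (h : ∀ j, π ^ t ∣ b j - u * a j) :
    IsUnit u := by
  rw [isUnit_iff_not_dvd hπ]
  intro hu
  refine (exists_isUnit_iff hπ).1 hb fun j => ?_
  have := dvd_add ((dvd_pow_self π (by omega)).trans (h j)) (hu.mul_right (a j))
  rwa [sub_add_cancel] at this

/-- If w ≡ v a mod π, then b ≡ (u + π^k v) a mod π^(k+1), and the new scalar is still 1 mod π^s
because s ≤ k. Failure at the next level thus makes w independent of a mod π, as `exists_dual_pair`
requires. -/
theorem not_forall_dvd_sub_of_not_scaling (hπ : maximalIdeal R = Ideal.span {π}) {s k : ℕ}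
    (hsk : s ≤ k) {a b : UnimodularTuple R n} (h : ¬ scalingSetoid π n s (k + 1) a b) {u : R}
    (hu : π ^ s ∣ u - 1) {w : Fin n → R} (hw : ∀ j, b.1 j = u * a.1 j + π ^ k * w j) (v : R) :
    ∃ j, ¬ π ∣ w j - v * a.1 j := by
  by_contra! hcon
  have h1 : ∀ j, π ^ (k + 1) ∣ b.1 j - (u + π ^ k * v) * a.1 j := by
    intro j
    rw [pow_succ]
    refine (mul_dvd_mul_left (π ^ k) (hcon j)).trans (dvd_of_eq ?_)
    rw [hw]
    ring
  have h2 := isUnit_of_forall_dvd_sub hπ (Nat.le_add_left 1 k) b.exists_isUnit h1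
  refine h ⟨h2.unit, ?_, h1⟩
  refine (dvd_add hu ((pow_dvd_pow π hsk).mul_right v)).trans (dvd_of_eq ?_)
  rw [IsUnit.unit_spec]
  ring

variable [Finite R]

theorem card_forall_dvd (hπ : maximalIdeal R = Ideal.span {π}) (n : ℕ) :
    Nat.card {b : Fin n → R // ∀ i, π ∣ b i} =
      (Nat.card (ResidueField R) ^ (nilpotencyClass π - 1)) ^ n := by
  rw [Nat.card_congr (Equiv.subtypePiEquivPi (p := fun _ x => π ∣ x)), Nat.card_pi,
    ← card_pow_dvd hπ (nilpotencyClass_uniformizer_pos hπ)]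
  simp

theorem card_unimodularTuple (hπ : maximalIdeal R = Ideal.span {π}) (n : ℕ) :
    Nat.card (UnimodularTuple R n) + (Nat.card (ResidueField R) ^ (nilpotencyClass π - 1)) ^ n =
      (Nat.card (ResidueField R) ^ nilpotencyClass π) ^ n := by
  have h1 : Nat.card (UnimodularTuple R n) = Nat.card {b : Fin n → R // ¬ ∀ i, π ∣ b i} :=
    Nat.card_congr (Equiv.subtypeEquivRight fun b =>
      span_range_eq_top_iff.trans (exists_isUnit_iff hπ))
  rw [h1, ← card_forall_dvd hπ, add_comm, card_subtype_add_card_not, Nat.card_fun,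
    Nat.card_eq_fintype_card (α := Fin n), Fintype.card_fin, card_eq_card_residueField_pow hπ]

/-- Translation by −a turns the scalar 1 + u into u ∈ π^s R. Since s ≥ 1, every such 1 + u is a unit
and unimodularity is automatic. -/
theorem card_scalingSetoid_class_of_pos (hπ : maximalIdeal R = Ideal.span {π}) {s t : ℕ}
    (hs : 1 ≤ s) (hst : s ≤ t) (ht : t ≤ nilpotencyClass π) (a : UnimodularTuple R n) :
    Nat.card {b // scalingSetoid π n s t a b} =
      Nat.card (ResidueField R) ^ (nilpotencyClass π - s) *
        (Nat.card (ResidueField R) ^ (nilpotencyClass π - t)) ^ (n - 1) := by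
  rw [← card_tuple_near_line hπ a.exists_isUnit hst ht]
  have hunit : ∀ u : R, π ^ s ∣ u → IsUnit (1 + u) := by
    intro u hu
    rw [isUnit_iff_not_dvd hπ]
    intro h
    have h1 : π ∣ 1 := (dvd_add_left ((dvd_pow_self π (by omega)).trans hu)).1 h
    exact (isUnit_iff_not_dvd hπ).1 isUnit_one h1
  refine Nat.card_congr
    { toFun := fun b => ⟨b.1.1 - a.1, ?_⟩
      invFun := fun b => ⟨⟨b.1 + a.1, ?_⟩, ?_⟩
      left_inv := fun b => Subtype.ext (Subtype.ext (sub_add_cancel _ _))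
      right_inv := fun b => by simp }
  · obtain ⟨u, hu, h⟩ := b.2
    refine ⟨u - 1, hu, fun j => (h j).trans (dvd_of_eq ?_)⟩
    simp only [Pi.sub_apply]
    ring
  · obtain ⟨u, hu, h⟩ := b.2
    rw [span_range_eq_top_iff, exists_isUnit_iff hπ]
    intro hcon
    refine (exists_isUnit_iff hπ).1 a.exists_isUnit fun j => ?_
    refine (hunit u hu).dvd_mul_right.1
      ((dvd_sub (hcon j) ((dvd_pow_self π (by omega : t ≠ 0)).trans (h j))).trans (dvd_of_eq ?_))
    simp only [Pi.add_apply]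
    ring
  · obtain ⟨u, hu, h⟩ := b.2
    refine ⟨(hunit u hu).unit, ?_, fun j => (h j).trans (dvd_of_eq ?_)⟩
    · simpa using hu
    · simp only [Pi.add_apply, IsUnit.unit_spec]
      ring

/-- Among the tuples near the whole line R a, those with u ∈ πR are exactly the non-unimodular ones;
they are the count with s = 1. -/
theorem card_scalingSetoid_class_zero (hπ : maximalIdeal R = Ideal.span {π}) {t : ℕ}
    (ht1 : 1 ≤ t) (ht : t ≤ nilpotencyClass π) (a : UnimodularTuple R n) :
    Nat.card {b // scalingSetoid π n 0 t a b} +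
      Nat.card (ResidueField R) ^ (nilpotencyClass π - 1) *
        (Nat.card (ResidueField R) ^ (nilpotencyClass π - t)) ^ (n - 1) =
      Nat.card (ResidueField R) ^ nilpotencyClass π *
        (Nat.card (ResidueField R) ^ (nilpotencyClass π - t)) ^ (n - 1) := by
  have h0 := card_tuple_near_line hπ a.exists_isUnit (Nat.zero_le t) ht
  rw [Nat.sub_zero] at h0
  rw [← h0, ← card_tuple_near_line hπ a.exists_isUnit ht1 ht,
    ← card_subtype_add_card_not (fun b : {b : Fin n → R // ∃ u, π ^ 0 ∣ u ∧
      ∀ j, π ^ t ∣ b j - u * a.1 j} => ¬ ∀ i, π ∣ b.1 i)]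
  congr 1
  · refine Nat.card_congr
      { toFun := fun b => ⟨⟨b.1.1, ?_⟩, ?_⟩
        invFun := fun b => ⟨⟨b.1.1, ?_⟩, ?_⟩
        left_inv := fun b => rfl
        right_inv := fun b => rfl }
    · obtain ⟨u, -, h⟩ := b.2
      exact ⟨u, by simp, h⟩
    · exact (exists_isUnit_iff hπ).1 b.1.exists_isUnit
    · exact span_range_eq_top_iff.2 ((exists_isUnit_iff hπ).2 b.2)
    · obtain ⟨u, -, h⟩ := b.1.2
      exact ⟨(isUnit_of_forall_dvd_sub hπ ht1 ((exists_isUnit_iff hπ).2 b.2) h).unit, by simp, h⟩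
  · refine Nat.card_congr
      { toFun := fun b => ⟨⟨b.1, ?_⟩, ?_⟩
        invFun := fun b => ⟨b.1.1, ?_⟩
        left_inv := fun b => rfl
        right_inv := fun b => rfl }
    · obtain ⟨u, -, h⟩ := b.2
      exact ⟨u, by simp, h⟩
    · obtain ⟨u, hu, h⟩ := b.2
      rw [not_not]
      intro i
      rw [pow_one] at hu
      have := dvd_add ((dvd_pow_self π (by omega)).trans (h i)) (hu.mul_right (a.1 i))
      rwa [sub_add_cancel] at this
    · obtain ⟨u, -, h⟩ := b.1.2
      refine ⟨u, ?_, h⟩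
      rw [pow_one]
      refine dvd_of_forall_dvd_mul a.exists_isUnit fun j => ?_
      have := dvd_sub (not_not.1 b.2 j) ((dvd_pow_self π (by omega)).trans (h j))
      rwa [sub_sub_cancel] at this

end Classes

/-! ### Common neighbours at each level -/

section Levels

open IsLocalRing

theorem card_subtype_fst_snd {α β : Type*} (P : α → Prop) (Q : β → Prop) :
    Nat.card {y : α × β // P y.1 ∧ Q y.2} = Nat.card {x // P x} * Nat.card {x // Q x} := by
  rw [← Nat.card_prod]
  exact Nat.card_congr Equiv.subtypeProdEquivProd

variable {R : Type*} [CommRing R] {n : ℕ}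

theorem dotProduct_eq_of_eq_add {a b w : Fin n → R} {u p : R}
    (h : ∀ j, b j = u * a j + p * w j) (c : Fin n → R) :
    dotProduct b c = u * dotProduct a c + p * dotProduct w c := by
  have : b = u • a + p • w := funext h
  rw [this, add_dotProduct, smul_dotProduct, smul_dotProduct, smul_eq_mul, smul_eq_mul]

/-- A solution of a·c = 1 is automatically unimodular, so the count may be made over the free
module. -/
theorem card_unimodular_dotProduct_eq_one (a b : UnimodularTuple R n) :
    Nat.card {c : UnimodularTuple R n // dotProduct a.1 c.1 = 1 ∧ dotProduct c.1 b.1 = 1} =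
      Nat.card {c : Fin n → R // dotProduct a.1 c = 1 ∧ dotProduct b.1 c = 1} := by
  refine Nat.card_congr
    { toFun := fun c => ⟨c.1.1, c.2.1, by rw [dotProduct_comm]; exact c.2.2⟩
      invFun := fun c => ⟨⟨c.1, ?_⟩, c.2.1, by rw [dotProduct_comm]; exact c.2.2⟩
      left_inv := fun c => rfl
      right_inv := fun c => rfl }
  have h : dotProduct a.1 c.1 ∈ Ideal.span (Set.range c.1) := Ideal.sum_mem _ fun i _ => Ideal.mul_mem_left _ _ (Ideal.subset_span ⟨i, rfl⟩)
  exact (Ideal.eq_top_iff_one _).2 (by rwa [c.2.1] at h)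

/-- Pairing b = u a + π^(k+1) w with a common neighbour gives 1 = u + π^(k+1)(w·c), which would
place the pair at the next level. -/
theorem card_common_neighbors_of_not_scaling {π : R} {k : ℕ} {a b : UnimodularTuple R n}
    (h : scalingSetoid π n k (k + 1) a b) (h' : ¬ scalingSetoid π n (k + 1) (k + 1) a b) :
    Nat.card {c : UnimodularTuple R n // dotProduct a.1 c.1 = 1 ∧ dotProduct c.1 b.1 = 1} = 0 := by
  have : IsEmpty {c : UnimodularTuple R n //
      dotProduct a.1 c.1 = 1 ∧ dotProduct c.1 b.1 = 1} := by
    refine ⟨fun c => ?_⟩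
    obtain ⟨u, hu, hb⟩ := h
    choose w hw using hb
    have h1 := dotProduct_eq_of_eq_add (b := b.1) (a := a.1) (p := π ^ (k + 1)) (w := w) (u := (u : R))
      (fun j => by linear_combination hw j) c.1.1
    rw [c.2.1, dotProduct_comm, c.2.2] at h1
    exact h' ⟨u, ⟨-dotProduct w c.1.1, by linear_combination (-1 : R) * h1⟩, fun j => ⟨w j, hw j⟩⟩
  exact Nat.card_of_isEmpty

variable [IsLocalRing R] {π : R} [Finite R]

theorem card_common_neighbors_self (hπ : maximalIdeal R = Ideal.span {π})
    (a : UnimodularTuple R (n + 1)) :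
    Nat.card {c : UnimodularTuple R (n + 1) // dotProduct a.1 c.1 = 1 ∧ dotProduct c.1 a.1 = 1} =
      Nat.card (ResidueField R) ^ (nilpotencyClass π * n) := by
  obtain ⟨e, he⟩ := exists_dotProduct_eq_one a.exists_isUnit
  have h := card_dotProduct he (fun y => y = 1)
  simp only [Nat.card_unique, one_mul] at h
  rw [card_unimodular_dotProduct_eq_one]
  simp only [and_self]
  rw [pow_mul, ← card_eq_card_residueField_pow hπ]
  refine Nat.eq_of_mul_eq_mul_right (Nat.card_pos (α := R)) ?_
  rw [h, pow_succ]

theorem card_common_neighbors_of_scaling (hπ : maximalIdeal R = Ideal.span {π}) {k : ℕ}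
    (hk : k ≤ nilpotencyClass π) {a b : UnimodularTuple R (n + 2)}
    (h : scalingSetoid π (n + 2) k k a b) (h' : ¬ scalingSetoid π (n + 2) k (k + 1) a b) :
    Nat.card {c : UnimodularTuple R (n + 2) // dotProduct a.1 c.1 = 1 ∧ dotProduct c.1 b.1 = 1} =
      Nat.card (ResidueField R) ^ (nilpotencyClass π * n + k) := by
  obtain ⟨u, hu, hb⟩ := h
  -- As u ≡ 1 mod π^k, the term (u − 1)a is absorbed into π^k w and the scalar becomes 1.
  have hw : ∀ j, ∃ w, b.1 j = 1 * a.1 j + π ^ k * w := by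
    intro j
    obtain ⟨w, hw⟩ := dvd_add (hb j) (hu.mul_right (a.1 j))
    exact ⟨w, by linear_combination hw⟩
  choose w hw using hw
  obtain ⟨d, e, he, hd, hwd⟩ := exists_dual_pair hπ a.exists_isUnit
    (not_forall_dvd_sub_of_not_scaling hπ le_rfl h' (by simp) hw)
  have h := card_dotProduct_pair he hd hwd (fun y => y.1 = 1 ∧ π ^ k * y.2 = 0)
  rw [card_subtype_fst_snd (fun x : R => x = 1) (fun x : R => π ^ k * x = 0),
    Nat.card_unique (α := {x : R // x = 1}), one_mul, card_annihilator_pow hπ hk] at h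
  rw [card_unimodular_dotProduct_eq_one, pow_add, pow_mul, ← card_eq_card_residueField_pow hπ]
  refine Nat.eq_of_mul_eq_mul_right
    (Nat.mul_pos (Nat.card_pos (α := R)) (Nat.card_pos (α := R))) ?_
  rw [show ∀ N K : ℕ, N ^ n * K * (N * N) = K * N ^ (n + 2) by intro N K; ring, ← h]
  congr 1
  refine Nat.card_congr (Equiv.subtypeEquivRight fun c => and_congr_right fun hc => ?_)
  rw [dotProduct_eq_of_eq_add hw, hc, one_mul, add_eq_left]

theorem card_unimodular_orthogonal_add (a b : UnimodularTuple R n)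
    (hπ : maximalIdeal R = Ideal.span {π}) :
    Nat.card {c : UnimodularTuple R n // dotProduct a.1 c.1 = 0 ∧ dotProduct c.1 b.1 = 0} +
      Nat.card {c : Fin n → R // (dotProduct a.1 c = 0 ∧ dotProduct b.1 c = 0) ∧ ∀ i, π ∣ c i} =
    Nat.card {c : Fin n → R // dotProduct a.1 c = 0 ∧ dotProduct b.1 c = 0} := by
  rw [← card_subtype_add_card_not (fun c : {c : Fin n → R // dotProduct a.1 c = 0 ∧
    dotProduct b.1 c = 0} => ¬ ∀ i, π ∣ c.1 i)]
  congr 1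
  · refine Nat.card_congr
      { toFun := fun c => ⟨⟨c.1.1, c.2.1, by rw [dotProduct_comm]; exact c.2.2⟩,
          (exists_isUnit_iff hπ).1 c.1.exists_isUnit⟩
        invFun := fun c => ⟨⟨c.1.1, span_range_eq_top_iff.2 ((exists_isUnit_iff hπ).2 c.2)⟩,
          c.1.2.1, by rw [dotProduct_comm]; exact c.1.2.2⟩
        left_inv := fun c => rfl
        right_inv := fun c => rfl }
  · exact Nat.card_congr
      { toFun := fun c => ⟨⟨c.1, c.2.1⟩, not_not.2 c.2.2⟩
        invFun := fun c => ⟨c.1.1, c.1.2, not_not.1 c.2⟩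
        left_inv := fun c => rfl
        right_inv := fun c => rfl }

theorem card_orthogonal_of_scaling (hπ : maximalIdeal R = Ideal.span {π}) {k : ℕ}
    (hk : k < nilpotencyClass π) {a b : UnimodularTuple R (n + 2)}
    (h : scalingSetoid π (n + 2) 0 k a b) (h' : ¬ scalingSetoid π (n + 2) 0 (k + 1) a b) :
    Nat.card {c : UnimodularTuple R (n + 2) // dotProduct a.1 c.1 = 0 ∧ dotProduct c.1 b.1 = 0} *
        Nat.card (ResidueField R) ^ n + Nat.card (ResidueField R) ^ (nilpotencyClass π * n + k) =
      Nat.card (ResidueField R) ^ (nilpotencyClass π * n + k + n) := by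
  obtain ⟨u, -, hb⟩ := h
  choose w hw using hb
  have hw' : ∀ j, b.1 j = u * a.1 j + π ^ k * w j := fun j => by linear_combination hw j
  obtain ⟨d, e, he, hd, hwd⟩ := exists_dual_pair hπ a.exists_isUnit
    (not_forall_dvd_sub_of_not_scaling hπ (Nat.zero_le k) h' (by simp) hw')
  have hiff : ∀ c, (dotProduct a.1 c = 0 ∧ dotProduct b.1 c = 0) ↔
      (dotProduct a.1 c = 0 ∧ π ^ k * dotProduct w c = 0) := by
    refine fun c => and_congr_right fun hc => ?_
    rw [dotProduct_eq_of_eq_add hw', hc, mul_zero, zero_add]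
  have hZ := card_dotProduct_pair he hd hwd (fun y => y.1 = 0 ∧ π ^ k * y.2 = 0)
  -- Substituting πc for c raises the exponents of π in the two conditions from 0 and k to 1 and k +
  -- 1; k < ℓ keeps the annihilator count valid at k + 1.
  have hY := card_dotProduct_pair he hd hwd (fun y => π ^ 1 * y.1 = 0 ∧ π ^ (k + 1) * y.2 = 0)
  rw [card_subtype_fst_snd (fun x : R => x = 0) (fun x : R => π ^ k * x = 0),
    Nat.card_unique (α := {x : R // x = 0}), one_mul, card_annihilator_pow hπ hk.le] at hZ
  rw [card_subtype_fst_snd (fun x : R => π ^ 1 * x = 0) (fun x : R => π ^ (k + 1) * x = 0),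
    card_annihilator_pow hπ hk, card_annihilator_pow hπ (by omega)] at hY
  dsimp only at hZ hY
  have hD := card_dvd_tuple hπ (fun c => dotProduct a.1 c = 0 ∧ dotProduct b.1 c = 0)
  have hD' : Nat.card {c : Fin (n + 2) → R // dotProduct a.1 (π • c) = 0 ∧
      dotProduct b.1 (π • c) = 0} = Nat.card {c : Fin (n + 2) → R //
        π ^ 1 * dotProduct a.1 c = 0 ∧ π ^ (k + 1) * dotProduct w c = 0} := by
    refine Nat.card_congr (Equiv.subtypeEquivRight fun c => ?_)
    rw [hiff, dotProduct_smul, dotProduct_smul, smul_eq_mul, smul_eq_mul, pow_one, pow_succ,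
      mul_assoc]
  rw [hD'] at hD
  have hS := card_unimodular_orthogonal_add a b hπ
  rw [Nat.card_congr (Equiv.subtypeEquivRight hiff)] at hS
  have hq : 0 < Nat.card R := Nat.card_pos
  have hq' : 0 < Nat.card (ResidueField R) := by
    have : Finite (ResidueField R) := Finite.of_surjective _ residue_surjective
    exact Nat.card_pos
  set X := Nat.card {c : UnimodularTuple R (n + 2) //
    dotProduct a.1 c.1 = 0 ∧ dotProduct c.1 b.1 = 0}
  set Y := Nat.card {c : Fin (n + 2) → R //
    (dotProduct a.1 c = 0 ∧ dotProduct b.1 c = 0) ∧ ∀ i, π ∣ c i}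
  set q := Nat.card (ResidueField R)
  have hR : Nat.card R = q ^ nilpotencyClass π := card_eq_card_residueField_pow hπ
  set r := Nat.card R
  rw [← hS] at hZ
  rw [← hD] at hY
  have e1 : q ^ (nilpotencyClass π * n + k) = r ^ n * q ^ k := by rw [hR, pow_add, pow_mul]
  rw [pow_add _ _ n, e1]
  have hrr : 0 < r * r := Nat.mul_pos hq hq
  have hZ' : X + Y = r ^ n * q ^ k := by
    refine Nat.eq_of_mul_eq_mul_right hrr ?_
    rw [hZ]; ring
  have hY' : Y * q ^ n = r ^ n * q ^ k := by
    refine Nat.eq_of_mul_eq_mul_right (Nat.mul_pos hrr (pow_pos hq' 2)) ?_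
    calc _ = Y * q ^ (n + 2) * (r * r) := by ring
      _ = _ := by rw [hY, Nat.succ_eq_add_one]; ring
  rw [← hZ', add_mul, hZ', hY']

theorem card_orthogonal_of_scaling_top (hπ : maximalIdeal R = Ideal.span {π})
    {a b : UnimodularTuple R (n + 1)} (h : scalingSetoid π (n + 1) 0 (nilpotencyClass π) a b) :
    Nat.card {c : UnimodularTuple R (n + 1) // dotProduct a.1 c.1 = 0 ∧ dotProduct c.1 b.1 = 0} *
        Nat.card (ResidueField R) ^ n + Nat.card (ResidueField R) ^ (nilpotencyClass π * n) =
      Nat.card (ResidueField R) ^ (nilpotencyClass π * n + n) := by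
  obtain ⟨u, -, hb⟩ := h
  rw [pow_nilpotencyClass_uniformizer hπ] at hb
  simp only [zero_dvd_iff, sub_eq_zero] at hb
  have hiff : ∀ c, (dotProduct a.1 c = 0 ∧ dotProduct b.1 c = 0) ↔ dotProduct a.1 c = 0 := by
    refine fun c => and_iff_left_of_imp fun hc => ?_
    rw [dotProduct_eq_of_eq_add (u := (u : R)) (p := 0) (w := 0) (a := a.1)
      (fun j => by rw [hb]; simp), hc, mul_zero, zero_mul, add_zero]
  obtain ⟨e, he⟩ := exists_dotProduct_eq_one a.exists_isUnit
  have hZ := card_dotProduct he (fun y => y = 0)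
  have hY := card_dotProduct he (fun y => π * y = 0)
  rw [Nat.card_unique (α := {x : R // x = 0}), one_mul] at hZ
  rw [card_annihilator_uniformizer hπ] at hY
  have hD := card_dvd_tuple hπ (fun c => dotProduct a.1 c = 0 ∧ dotProduct b.1 c = 0)
  have hD' : Nat.card {c : Fin (n + 1) → R // dotProduct a.1 (π • c) = 0 ∧
      dotProduct b.1 (π • c) = 0} = Nat.card {c : Fin (n + 1) → R //
        π * dotProduct a.1 c = 0} := by
    refine Nat.card_congr (Equiv.subtypeEquivRight fun c => ?_)
    rw [hiff, dotProduct_smul, smul_eq_mul]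
  rw [hD'] at hD
  have hS := card_unimodular_orthogonal_add a b hπ
  rw [Nat.card_congr (Equiv.subtypeEquivRight hiff)] at hS
  have hq : 0 < Nat.card R := Nat.card_pos
  have hq' : 0 < Nat.card (ResidueField R) := by
    have : Finite (ResidueField R) := Finite.of_surjective _ residue_surjective
    exact Nat.card_pos
  set X := Nat.card {c : UnimodularTuple R (n + 1) //
    dotProduct a.1 c.1 = 0 ∧ dotProduct c.1 b.1 = 0}
  set Y := Nat.card {c : Fin (n + 1) → R //
    (dotProduct a.1 c = 0 ∧ dotProduct b.1 c = 0) ∧ ∀ i, π ∣ c i}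
  set q := Nat.card (ResidueField R)
  have hR : Nat.card R = q ^ nilpotencyClass π := card_eq_card_residueField_pow hπ
  set r := Nat.card R
  rw [← hS] at hZ
  rw [← hD] at hY
  rw [pow_add, pow_mul, ← hR]
  have hZ' : X + Y = r ^ n := by
    refine Nat.eq_of_mul_eq_mul_right hq ?_
    rw [hZ]; ring
  have hY' : Y * q ^ n = r ^ n := by
    refine Nat.eq_of_mul_eq_mul_right (Nat.mul_pos hq hq') ?_
    calc _ = Y * q ^ (n + 1) * r := by ring
      _ = _ := by rw [hY]; ring
  rw [← hZ', add_mul, hZ', hY']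

end Levels

/-! ### Numerical recursion for Um -/

section UmArithmetic

/-- The sizes of the classes in the chain of equivalence relations for `Um(R^(p+2))`. -/
def umClassCard (q ℓ p : ℕ) : ℕ → ℕ
  | 0 => q ^ (ℓ * (p + 2)) - q ^ ((ℓ - 1) * (p + 2))
  | 1 => (q - 1) * q ^ ((ℓ - 1) * (p + 2))
  | i + 2 => q ^ (ℓ - (i + 2) / 2) * (q ^ (ℓ - (i + 3) / 2)) ^ (p + 1)

/-- The number of common neighbours in `Um(R^(p+2))` of two vertices, by their level. -/
def umCommonNeighbors (q ℓ p i : ℕ) : ℕ :=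
  if Even i then q ^ (ℓ * p + i / 2) else 0

/-- The squares of the eigenvalues of `Um(R^(p+2))`. -/
def umEigenvalueSq (q ℓ p : ℕ) : ℕ → ℕ
  | 0 => q ^ (2 * (p + 1) * ℓ)
  | 1 => q ^ (2 * (p + 1) * (ℓ - 1) + p)
  | i + 2 => if Even i then q ^ ((p + 1) * (2 * ℓ - (i / 2 + 1))) else 0

variable {q ℓ p : ℕ}

theorem umClassCard_succ_lt (hq : 2 < q) {i : ℕ} (hi : i < 2 * ℓ) :
    umClassCard q ℓ p (i + 1) < umClassCard q ℓ p i := by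
  have hq0 : 0 < q := by omega
  match i with
  | 0 =>
    obtain ⟨L, rfl⟩ : ∃ L, ℓ = L + 1 := ⟨ℓ - 1, by omega⟩
    simp only [umClassCard, Nat.add_sub_cancel]
    have h1 : q ^ ((L + 1) * (p + 2)) = q ^ (L * (p + 2)) * q ^ (p + 2) := by ring
    have h2 : q < q ^ (p + 2) := by
      conv_lhs => rw [← pow_one q]
      exact Nat.pow_lt_pow_right (by omega) (by omega)
    have h3 : 0 < q ^ (L * (p + 2)) := pow_pos hq0 _
    have h4 : q ^ (L * (p + 2)) * q < q ^ (L * (p + 2)) * q ^ (p + 2) :=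
      Nat.mul_lt_mul_of_pos_left h2 h3
    obtain ⟨Q, rfl⟩ : ∃ Q, q = Q + 1 := ⟨q - 1, by omega⟩
    rw [h1, Nat.add_sub_cancel, Nat.lt_sub_iff_add_lt]
    refine lt_of_eq_of_lt ?_ h4
    ring
  -- The ratio of the two class sizes is q − 1, the number of nonzero residues, so strictness here
  -- needs q > 2.
  | 1 =>
    obtain ⟨L, rfl⟩ : ∃ L, ℓ = L + 1 := ⟨ℓ - 1, by omega⟩
    simp only [umClassCard, Nat.add_sub_cancel]
    have h3 : 0 < q ^ (L * (p + 2)) := pow_pos hq0 _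
    have h4 : q ^ L * (q ^ L) ^ (p + 1) = 1 * q ^ (L * (p + 2)) := by ring
    rw [h4]
    exact Nat.mul_lt_mul_of_pos_right (by omega) h3
  | i + 2 =>
    simp only [umClassCard]
    rcases Nat.even_or_odd' i with ⟨k, rfl | rfl⟩
    · rw [show (2 * k + 1 + 2) / 2 = k + 1 by omega, show (2 * k + 1 + 3) / 2 = k + 2 by omega,
        show (2 * k + 2) / 2 = k + 1 by omega]
      exact Nat.mul_lt_mul_of_pos_left (Nat.pow_lt_pow_left
        (Nat.pow_lt_pow_right (by omega) (by omega)) (by omega)) (pow_pos hq0 _)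
    · rw [show (2 * k + 1 + 1 + 2) / 2 = k + 2 by omega,
        show (2 * k + 1 + 1 + 3) / 2 = k + 2 by omega,
        show (2 * k + 1 + 2) / 2 = k + 1 by omega]
      exact Nat.mul_lt_mul_of_pos_right (Nat.pow_lt_pow_right (by omega) (by omega))
        (pow_pos (pow_pos hq0 _) _)

theorem umEigenvalueSq_zero (hq : 2 < q) (hℓ : 0 < ℓ) :
    (umEigenvalueSq q ℓ p 0 : ℂ) =
      umEigenvalueSq q ℓ p 1 + (umCommonNeighbors q ℓ p 0 : ℂ) * (umClassCard q ℓ p 0 : ℂ) := by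
  obtain ⟨L, rfl⟩ : ∃ L, ℓ = L + 1 := ⟨ℓ - 1, by omega⟩
  have hle : q ^ ((L + 1 - 1) * (p + 2)) ≤ q ^ ((L + 1) * (p + 2)) :=
    Nat.pow_le_pow_right (by omega) (Nat.mul_le_mul_right _ (by omega))
  simp only [umEigenvalueSq, umCommonNeighbors, umClassCard]
  rw [Nat.cast_sub hle]
  simp only [Nat.add_sub_cancel, Even.zero, if_true]
  push_cast
  ring

theorem umEigenvalueSq_succ (hq : 2 < q) {i : ℕ} (hi : i < 2 * ℓ) :
    (umEigenvalueSq q ℓ p (i + 1) : ℂ) = umEigenvalueSq q ℓ p (i + 2) +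
      ((umCommonNeighbors q ℓ p (i + 1) : ℂ) - umCommonNeighbors q ℓ p i) *
        (umClassCard q ℓ p (i + 1) : ℂ) := by
  rcases Nat.even_or_odd' i with ⟨k, rfl | rfl⟩
  · obtain ⟨d, rfl⟩ : ∃ d, ℓ = k + d + 1 := ⟨ℓ - k - 1, by omega⟩
    have h1 : ¬ Even (2 * k + 1) := by simp
    have h2 : Even (2 * k) := by simp
    -- Level 1 stands apart: its class size and its eigenvalue do not follow the later pattern.
    cases k with
    | zero =>
      simp only [umEigenvalueSq, umCommonNeighbors, umClassCard, h1, h2, if_true, if_false]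
      rw [show 2 * (0 + d + 1) - (2 * 0 / 2 + 1) = 2 * d + 1 by omega,
        show 0 + d + 1 - 1 = d by omega]
      push_cast [Nat.cast_sub (show 1 ≤ q by omega)]
      norm_num
      ring
    | succ k =>
      have h3 : ¬ Even (2 * k + 1) := by simp
      rw [show 2 * (k + 1) = 2 * k + 2 by ring] at h1 h2 ⊢
      rw [show 2 * k + 2 + 1 = 2 * k + 1 + 2 by ring] at h1 ⊢
      simp only [umEigenvalueSq, umCommonNeighbors, umClassCard, h1, h2, h3, if_true, if_false]
      rw [show 2 * (k + 1 + d + 1) - ((2 * k + 2) / 2 + 1) = k + 2 * d + 2 by omega,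
        show (2 * k + 1 + 2) / 2 = k + 1 by omega, show (2 * k + 2) / 2 = k + 1 by omega,
        show (2 * k + 1 + 3) / 2 = k + 2 by omega, show k + 1 + d + 1 - (k + 1) = d + 1 by omega,
        show k + 1 + d + 1 - (k + 2) = d by omega]
      push_cast
      ring
  · obtain ⟨d, rfl⟩ : ∃ d, ℓ = k + d + 1 := ⟨ℓ - k - 1, by omega⟩
    have h1 : ¬ Even (2 * k + 1) := by simp
    have h2 : Even (2 * k) := by simp
    have h3 : Even (2 * k + 1 + 1) := by rw [show 2 * k + 1 + 1 = 2 * (k + 1) by ring]; simp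
    simp only [umEigenvalueSq, umCommonNeighbors, umClassCard, h1, h2, h3, if_true, if_false]
    rw [show 2 * (k + d + 1) - (2 * k / 2 + 1) = k + 2 * d + 1 by omega,
      show (2 * k + 1 + 1) / 2 = k + 1 by omega,
      show (2 * k + 3) / 2 = k + 1 by omega, show k + d + 1 - (k + 1) = d by omega]
    push_cast
    ring

end UmArithmetic

/-! ### The spectrum of Um -/

section UmSpectrum

open IsLocalRing

theorem two_lt_card_residueField {R : Type*} [CommRing R] [IsLocalRing R] [Finite R]
    (h : Odd (Nat.card (ResidueField R))) : 2 < Nat.card (ResidueField R) := by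
  have : Finite (ResidueField R) := Finite.of_surjective _ residue_surjective
  have h1 : 1 < Nat.card (ResidueField R) := Finite.one_lt_card
  obtain ⟨k, hk⟩ := h
  omega

theorem mem_adjacencyEigenvalues_unimodularGraph {R : Type*} [CommRing R] [IsLocalRing R]
    [Finite R] {π : R} (hπ : maximalIdeal R = Ideal.span {π})
    (hq : Odd (Nat.card (ResidueField R))) (p : ℕ) (z : ℂ) :
    z ∈ adjacencyEigenvalues (unimodularGraph R (p + 2)) ↔
      ∃ i ≤ 2 * nilpotencyClass π, z ^ 2 =
        (umEigenvalueSq (Nat.card (ResidueField R)) (nilpotencyClass π) p i : ℂ) := by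
  classical
  have : Fintype (UnimodularTuple R (p + 2)) := Fintype.ofFinite _
  have hq2 := two_lt_card_residueField hq
  have hℓ := nilpotencyClass_uniformizer_pos hπ
  have hnil := pow_nilpotencyClass_uniformizer hπ
  unfold unimodularGraph
  rw [mem_adjacencyEigenvalues_bipartiteGraphOf
    (fun a b h => by rw [dotProduct_comm]; exact h)]
  set q := Nat.card (ResidueField R) with hqdef
  set ℓ := nilpotencyClass π with hℓdef
  have : Nonempty (UnimodularTuple R (p + 2)) :=
    ⟨⟨fun _ => 1, span_range_eq_top_iff.2 ⟨0, isUnit_one⟩⟩⟩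
  -- The floors of i/2 and (i+1)/2 make the relations refine the direction and the scalar
  -- alternately, ending at equality for i = 2ℓ.
  refine hasEigenvalue_chain_iff (r := fun i => scalingSetoid π (p + 2) (i / 2) ((i + 1) / 2))
    (s := umClassCard q ℓ p) (N := fun i => (umCommonNeighbors q ℓ p i : ℂ))
    (θ := fun i => (umEigenvalueSq q ℓ p i : ℂ)) (m := 2 * ℓ) ?_ ?_ ?_ ?_
    (fun i hi => umClassCard_succ_lt hq2 hi) ?_ (umEigenvalueSq_zero hq2 hℓ)
    (fun i hi => umEigenvalueSq_succ hq2 hi) ?_ (z ^ 2)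
  · exact fun i j hij => scalingSetoid_mono (Nat.div_le_div_right hij)
      (Nat.div_le_div_right (by omega))
  · exact scalingSetoid_zero_zero
  · rw [show (2 * ℓ + 1) / 2 = ℓ by omega, show 2 * ℓ / 2 = ℓ by omega]
    exact scalingSetoid_eq_bot hnil
  · intro i hi a
    match i with
    | 0 =>
      change Nat.card {b // scalingSetoid π (p + 2) 0 0 a b} = _
      rw [scalingSetoid_zero_zero]
      have h := card_unimodularTuple hπ (p + 2)
      rw [← hqdef, ← hℓdef, ← pow_mul, ← pow_mul] at h
      rw [umClassCard, ← h, Nat.add_sub_cancel]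
      exact Nat.card_congr (Equiv.subtypeUnivEquiv fun _ => trivial)
    | 1 =>
      change Nat.card {b // scalingSetoid π (p + 2) 0 1 a b} = _
      have h := card_scalingSetoid_class_zero hπ le_rfl hℓ a
      rw [← hqdef, ← hℓdef] at h
      refine Nat.add_right_cancel (h.trans ?_)
      obtain ⟨L, hL⟩ : ∃ L, ℓ = L + 1 := ⟨ℓ - 1, by omega⟩
      obtain ⟨Q, hQ⟩ : ∃ Q, q = Q + 1 := ⟨q - 1, by omega⟩
      simp only [hL, hQ, umClassCard, Nat.add_sub_cancel, show p + 2 - 1 = p + 1 by omega]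
      ring
    | i + 2 =>
      exact card_scalingSetoid_class_of_pos hπ (s := (i + 2) / 2) (t := (i + 3) / 2) (by omega)
        (by omega) (by omega) a
  · intro i hi a b h h'
    rw [relMatrix_mul_apply, Nat.cast_inj]
    rcases Nat.even_or_odd' i with ⟨k, rfl | rfl⟩
    · simp only [umCommonNeighbors, even_two_mul, if_true]
      rw [show (2 * k + 1) / 2 = k by omega, show 2 * k / 2 = k by omega] at h
      rw [show 2 * k / 2 = k by omega]
      rcases Nat.lt_or_ge k ℓ with hk | hk
      · have h2 := h' (by omega)
        rw [show (2 * k + 1) / 2 = k by omega, show (2 * k + 1 + 1) / 2 = k + 1 by omega] at h2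
        exact card_common_neighbors_of_scaling hπ hk.le h h2
      · obtain rfl : k = ℓ := by omega
        rw [scalingSetoid_eq_bot hnil] at h
        obtain rfl : a = b := h
        exact card_common_neighbors_self hπ a
    · have h2 := h' (by omega)
      rw [show (2 * k + 1 + 1) / 2 = k + 1 by omega, show (2 * k + 1) / 2 = k by omega] at h
      rw [show (2 * k + 1 + 1) / 2 = k + 1 by omega,
        show (2 * k + 1 + 1 + 1) / 2 = k + 1 by omega] at h2
      rw [card_common_neighbors_of_not_scaling h h2, umCommonNeighbors, if_neg (by simp)]
  -- The index 2ℓ + 1 falls in the odd branch, whose value 0 is the terminal condition of the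
  -- recursion.
  · obtain ⟨L, hL⟩ : ∃ L, ℓ = L + 1 := ⟨ℓ - 1, by omega⟩
    rw [show 2 * ℓ + 1 = 2 * L + 1 + 2 by omega, umEigenvalueSq, if_neg (by simp), Nat.cast_zero]

/-- Complex square roots of natural powers, through real powers. -/
theorem sq_eq_natCast_pow_iff {q : ℕ} {e : ℝ} {E : ℕ} (he : e * 2 = E) (z : ℂ) :
    z ^ 2 = ((q ^ E : ℕ) : ℂ) ↔ z = (((q : ℝ) ^ e : ℝ) : ℂ) ∨ z = ((-(q : ℝ) ^ e : ℝ) : ℂ) := by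
  have h : ((q ^ E : ℕ) : ℂ) = (((q : ℝ) ^ e : ℝ) : ℂ) ^ 2 := by
    rw [← Complex.ofReal_pow, ← Real.rpow_mul_natCast (Nat.cast_nonneg q), Nat.cast_ofNat, he,
      Real.rpow_natCast]
    push_cast
    rfl
  rw [h, sq_eq_sq_iff_eq_or_eq_neg, Complex.ofReal_neg]

theorem exists_sq_eq_umEigenvalueSq_iff {q ℓ p : ℕ} (hℓ : 0 < ℓ) (z : ℂ) :
    (∃ i ≤ 2 * ℓ, z ^ 2 = (umEigenvalueSq q ℓ p i : ℂ)) ↔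
      z ^ 2 = ((q ^ (2 * (p + 1) * ℓ) : ℕ) : ℂ) ∨
      z ^ 2 = ((q ^ (2 * (p + 1) * (ℓ - 1) + p) : ℕ) : ℂ) ∨
      (∃ k, 1 ≤ k ∧ k ≤ ℓ ∧ z ^ 2 = ((q ^ ((p + 1) * (2 * ℓ - k)) : ℕ) : ℂ)) ∨
      (ℓ ≠ 1 ∧ z = 0) := by
  constructor
  · rintro ⟨i, hi, h⟩
    match i with
    | 0 => exact Or.inl h
    | 1 => exact Or.inr (Or.inl h)
    | i + 2 =>
      rcases Nat.even_or_odd' i with ⟨k, rfl | rfl⟩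
      · rw [umEigenvalueSq, if_pos (by simp), Nat.mul_div_cancel_left k two_pos] at h
        exact Or.inr (Or.inr (Or.inl ⟨k + 1, by omega, by omega, h⟩))
      · rw [umEigenvalueSq, if_neg (by simp), Nat.cast_zero] at h
        exact Or.inr (Or.inr (Or.inr ⟨by omega, by simpa using h⟩))
  · rintro (h | h | ⟨k, hk, hk', h⟩ | ⟨hℓ1, rfl⟩)
    · exact ⟨0, by omega, h⟩
    · exact ⟨1, by omega, h⟩
    · refine ⟨2 * (k - 1) + 2, by omega, ?_⟩
      rw [umEigenvalueSq, if_pos (by simp), Nat.mul_div_cancel_left _ two_pos,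
        Nat.sub_add_cancel hk]
      exact h
    -- Index 3 is the first with eigenvalue 0; it lies within 2ℓ exactly because ℓ ≥ 2.
    · exact ⟨1 + 2, by omega, by simp [umEigenvalueSq]⟩

theorem adjacencyEigenvalues_unimodularGraph {R : Type*} [CommRing R] [Finite R] [IsLocalRing R]
    {π : R} (hπ : maximalIdeal R = Ideal.span {π}) {q ℓ n : ℕ}
    (hq : q = Nat.card (ResidueField R)) (hq_odd : Odd q) (hℓ : ℓ = nilpotencyClass π)
    (hn : 2 ≤ n) :
    adjacencyEigenvalues (unimodularGraph R n) =
      (fun x : ℝ => (x : ℂ)) ''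
        {x : ℝ |
          (x = (q : ℝ) ^ (((n : ℝ) - 1) * ℓ) ∨ x = -(q : ℝ) ^ (((n : ℝ) - 1) * ℓ)) ∨
          (x = (q : ℝ) ^ (((n : ℝ) - 1) * ℓ - n / 2) ∨
            x = -(q : ℝ) ^ (((n : ℝ) - 1) * ℓ - n / 2)) ∨
          (∃ k : ℕ, 1 ≤ k ∧ k ≤ ℓ ∧
            (x = (q : ℝ) ^ (((n : ℝ) - 1) * (ℓ - k / 2)) ∨
              x = -(q : ℝ) ^ (((n : ℝ) - 1) * (ℓ - k / 2)))) ∨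
          (¬ IsField R ∧ x = 0)} := by
  obtain ⟨p, rfl⟩ : ∃ p, n = p + 2 := ⟨n - 2, by omega⟩
  have hpos : 0 < ℓ := by rw [hℓ]; exact nilpotencyClass_uniformizer_pos hπ
  ext z
  rw [mem_adjacencyEigenvalues_unimodularGraph hπ (hq ▸ hq_odd), ← hq, ← hℓ,
    exists_sq_eq_umEigenvalueSq_iff hpos, isField_iff_nilpotencyClass hπ, ← hℓ]
  have hk : ∀ k ≤ ℓ, (z ^ 2 = ((q ^ ((p + 1) * (2 * ℓ - k)) : ℕ) : ℂ) ↔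
      z = (((q : ℝ) ^ ((((p + 2 : ℕ) : ℝ) - 1) * (ℓ - k / 2)) : ℝ) : ℂ) ∨
      z = ((-(q : ℝ) ^ ((((p + 2 : ℕ) : ℝ) - 1) * (ℓ - k / 2)) : ℝ) : ℂ)) := by
    intro k hk
    refine sq_eq_natCast_pow_iff ?_ z
    push_cast [Nat.cast_sub (show k ≤ 2 * ℓ by omega)]
    ring
  rw [sq_eq_natCast_pow_iff (e := (((p + 2 : ℕ) : ℝ) - 1) * ℓ) (by push_cast; ring),
    sq_eq_natCast_pow_iff (e := (((p + 2 : ℕ) : ℝ) - 1) * ℓ - ((p + 2 : ℕ) : ℝ) / 2)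
      (by push_cast [Nat.cast_sub (show 1 ≤ ℓ from hpos)]; ring)]
  constructor
  · rintro ((h | h) | (h | h) | ⟨k, hk1, hk2, h⟩ | ⟨h1, h⟩)
    · exact ⟨_, Or.inl (Or.inl rfl), h.symm⟩
    · exact ⟨_, Or.inl (Or.inr rfl), h.symm⟩
    · exact ⟨_, Or.inr (Or.inl (Or.inl rfl)), h.symm⟩
    · exact ⟨_, Or.inr (Or.inl (Or.inr rfl)), h.symm⟩
    · rcases (hk k hk2).1 h with h | h
      · exact ⟨_, Or.inr (Or.inr (Or.inl ⟨k, hk1, hk2, Or.inl rfl⟩)), h.symm⟩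
      · exact ⟨_, Or.inr (Or.inr (Or.inl ⟨k, hk1, hk2, Or.inr rfl⟩)), h.symm⟩
    · exact ⟨0, Or.inr (Or.inr (Or.inr ⟨h1, rfl⟩)), by simp [h]⟩
  · rintro ⟨x, (h | h) | (h | h) | ⟨k, hk1, hk2, h⟩ | ⟨h1, h⟩, rfl⟩
    · exact Or.inl (Or.inl (congrArg _ h))
    · exact Or.inl (Or.inr (congrArg _ h))
    · exact Or.inr (Or.inl (Or.inl (congrArg _ h)))
    · exact Or.inr (Or.inl (Or.inr (congrArg _ h)))
    · refine Or.inr (Or.inr (Or.inl ⟨k, hk1, hk2, (hk k hk2).2 ?_⟩))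
      exact h.imp (congrArg _) (congrArg _)
    · exact Or.inr (Or.inr (Or.inr ⟨h1, by simp [h]⟩))

end UmSpectrum

/-! ### Numerical recursion for Um₀ -/

section UmZeroArithmetic

/-- The sizes of the classes in the chain of equivalence relations for `Um₀(R^(p+3))`. -/
def umZeroClassCard (q ℓ p : ℕ) : ℕ → ℕ
  | 0 => q ^ ((ℓ - 1) * (p + 2)) * ∑ i ∈ Finset.range (p + 3), q ^ i
  | k + 1 => q ^ ((p + 2) * (ℓ - (k + 1)))

/-- The number of common neighbours in `Um₀(R^(p+3))` of two vertices, by their level. -/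
def umZeroCommonNeighbors (q ℓ p k : ℕ) : ℕ :=
  if k < ℓ then q ^ ((ℓ - 1) * p + k) * ∑ i ∈ Finset.range (p + 1), q ^ i
  else q ^ ((ℓ - 1) * (p + 1)) * ∑ i ∈ Finset.range (p + 2), q ^ i

/-- The squares of the eigenvalues of `Um₀(R^(p+3))`. -/
def umZeroEigenvalueSq (q ℓ p : ℕ) : ℕ → ℕ
  | 0 => (q ^ ((ℓ - 1) * (p + 1)) * ∑ i ∈ Finset.range (p + 2), q ^ i) ^ 2
  | k + 1 => if k < ℓ then q ^ ((p + 1) * (2 * ℓ - (k + 1))) else 0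

variable {q ℓ p : ℕ}

theorem umZeroClassCard_succ_lt (hq : 2 < q) {i : ℕ} (hi : i < ℓ) :
    umZeroClassCard q ℓ p (i + 1) < umZeroClassCard q ℓ p i := by
  cases i with
  | zero =>
    rw [umZeroClassCard, umZeroClassCard, Finset.sum_range_succ']
    rw [mul_comm (p + 2), zero_add]
    refine lt_mul_of_one_lt_right (pow_pos (by omega) _) ?_
    have : 0 < ∑ i ∈ Finset.range (p + 2), q ^ (i + 1) :=
      Finset.sum_pos (fun i _ => pow_pos (by omega) _) ⟨0, by simp⟩
    rw [pow_zero]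
    omega
  | succ i =>
    rw [umZeroClassCard, umZeroClassCard]
    exact Nat.pow_lt_pow_right (by omega) (Nat.mul_lt_mul_of_pos_left (by omega) (by omega))

theorem umZeroEigenvalueSq_zero (hℓ : 0 < ℓ) :
    (umZeroEigenvalueSq q ℓ p 0 : ℂ) = umZeroEigenvalueSq q ℓ p 1 +
      (umZeroCommonNeighbors q ℓ p 0 : ℂ) * (umZeroClassCard q ℓ p 0 : ℂ) := by
  obtain ⟨L, rfl⟩ : ∃ L, ℓ = L + 1 := ⟨ℓ - 1, by omega⟩
  rw [umZeroEigenvalueSq, umZeroEigenvalueSq, umZeroCommonNeighbors, umZeroClassCard, if_pos hℓ,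
    if_pos hℓ, show 2 * (L + 1) - (0 + 1) = 2 * L + 1 by omega]
  simp only [Nat.add_sub_cancel, Finset.sum_range_succ _ (p + 1), Finset.sum_range_succ _ (p + 2)]
  have hG := geom_sum_mul (q : ℂ) (p + 1)
  push_cast
  set G := ∑ i ∈ Finset.range (p + 1), (q : ℂ) ^ i
  linear_combination (-(q : ℂ) ^ (2 * L * (p + 1) + (p + 1))) * hG

theorem umZeroEigenvalueSq_succ {i : ℕ} (hi : i < ℓ) :
    (umZeroEigenvalueSq q ℓ p (i + 1) : ℂ) = umZeroEigenvalueSq q ℓ p (i + 2) +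
      ((umZeroCommonNeighbors q ℓ p (i + 1) : ℂ) - umZeroCommonNeighbors q ℓ p i) *
        (umZeroClassCard q ℓ p (i + 1) : ℂ) := by
  have hG := geom_sum_mul (q : ℂ) (p + 1)
  rw [umZeroEigenvalueSq, umZeroEigenvalueSq, umZeroCommonNeighbors, umZeroCommonNeighbors,
    umZeroClassCard, if_pos hi, if_pos hi]
  rcases Nat.lt_or_ge (i + 1) ℓ with h | h
  · obtain ⟨d, rfl⟩ : ∃ d, ℓ = i + d + 2 := ⟨ℓ - i - 2, by omega⟩
    rw [if_pos h, if_pos h, show 2 * (i + d + 2) - (i + 1) = i + 2 * d + 3 by omega,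
      show 2 * (i + d + 2) - (i + 1 + 1) = i + 2 * d + 2 by omega,
      show i + d + 2 - 1 = i + d + 1 by omega, show i + d + 2 - (i + 1) = d + 1 by omega]
    push_cast
    set G := ∑ i ∈ Finset.range (p + 1), (q : ℂ) ^ i
    linear_combination (-(q : ℂ) ^ ((p + 1) * (i + 2 * d + 2))) * hG
  · obtain rfl : ℓ = i + 1 := by omega
    rw [if_neg (by omega), if_neg (by omega), show 2 * (i + 1) - (i + 1) = i + 1 by omega,
      Nat.sub_self, Nat.add_sub_cancel, Finset.sum_range_succ _ (p + 1)]
    push_cast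
    ring

end UmZeroArithmetic

/-! ### The spectrum of Um₀ -/

section UmZeroSpectrum

open IsLocalRing

/-- Some entry of a unimodular tuple is a unit, so the units act freely and every orbit has |R^×|
elements. -/
theorem card_subtype_proj {R : Type*} [CommRing R] [IsLocalRing R] [Finite R] {n : ℕ}
    (P : ProjUnimodularTuple R n → Prop) :
    Nat.card {a : UnimodularTuple R n // P (Quotient.mk _ a)} =
      Nat.card {x // P x} * Nat.card Rˣ := by
  classical
  have := Fintype.ofFinite (ProjUnimodularTuple R n)
  let f : UnimodularTuple R n → ProjUnimodularTuple R n := Quotient.mk _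
  have hfib : ∀ x : ProjUnimodularTuple R n, Nat.card {a // f a = x} = Nat.card Rˣ := by
    intro x
    obtain ⟨a, rfl⟩ := Quotient.exists_rep x
    obtain ⟨i, hi⟩ := a.exists_isUnit
    let g : Rˣ → {b // f b = f a} := fun u => ⟨⟨u • a.1, span_range_eq_top_iff.2
      ⟨i, u.isUnit.mul hi⟩⟩, Quotient.sound ⟨u, rfl⟩⟩
    refine (Nat.card_eq_of_bijective g ⟨fun u v h => ?_, fun b => ?_⟩).symm
    · have h1 := congrFun (congrArg (fun b => b.1.1) h) i
      exact Units.ext (hi.mul_right_cancel h1)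
    · obtain ⟨u, hu⟩ := Quotient.exact b.2
      exact ⟨u, Subtype.ext (Subtype.ext hu)⟩
  have hP : ∀ y : {y // P y}, Nat.card {a : {a // P (f a)} // (⟨f a.1, a.2⟩ : {y // P y}) = y} =
      Nat.card Rˣ := by
    rintro ⟨y, hy⟩
    rw [← hfib y]
    exact Nat.card_congr
      { toFun := fun x => ⟨x.1.1, congrArg Subtype.val x.2⟩
        invFun := fun x => ⟨⟨x.1, by rw [x.2]; exact hy⟩, Subtype.ext x.2⟩
        left_inv := fun x => rfl
        right_inv := fun x => rfl }
  change Nat.card {a // P (f a)} = _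
  rw [Nat.card_congr (Equiv.sigmaFiberEquiv (fun x : {a // P (f a)} =>
    (⟨f x.1, x.2⟩ : {y // P y}))).symm, Nat.card_sigma, Finset.sum_congr rfl fun y _ => hP y,
    Finset.sum_const, smul_eq_mul, Finset.card_univ, Nat.card_eq_fintype_card (α := {y // P y})]

/-- Equality of points modulo `π ^ k`, on unimodular tuples modulo units. -/
noncomputable def projSetoid {R : Type*} [CommRing R] (π : R) (n k : ℕ) :
    Setoid (ProjUnimodularTuple R n) :=
  (scalingSetoid π n 0 k).comap Quotient.out

/-- The chosen representative of the class of `b` is a unit multiple of `b`, and with s = 0 the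
relation ignores unit factors. -/
theorem projSetoid_mk_iff {R : Type*} [CommRing R] {π : R} {n k : ℕ}
    {x : ProjUnimodularTuple R n} {b : UnimodularTuple R n} :
    projSetoid π n k x (Quotient.mk _ b) ↔ scalingSetoid π n 0 k x.out b := by
  have h : scalingSetoid π n 0 k (Quotient.out (Quotient.mk (unimodularTupleSetoid R n) b)) b := by
    obtain ⟨u, hu⟩ := Quotient.exact
      (Quotient.out_eq (Quotient.mk (unimodularTupleSetoid R n) b)).symm
    refine ⟨u, by simp, fun j => ?_⟩
    have hj : (u : R) * (Quotient.out (Quotient.mk (unimodularTupleSetoid R n) b)).1 j = b.1 j :=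
      congrFun hu j
    rw [hj, sub_self]
    exact dvd_zero _
  exact ⟨fun h' => (scalingSetoid π n 0 k).trans' h' h,
    fun h' => (scalingSetoid π n 0 k).trans' h' ((scalingSetoid π n 0 k).symm' h)⟩

theorem orthogonal_mk_iff {R : Type*} [CommRing R] {n : ℕ} {x y : ProjUnimodularTuple R n}
    {c : UnimodularTuple R n} : (x.Orthogonal (Quotient.mk _ c) ∧
      ProjUnimodularTuple.Orthogonal (Quotient.mk _ c) y) ↔
      (dotProduct x.out.1 c.1 = 0 ∧ dotProduct c.1 y.out.1 = 0) := by
  conv_lhs => rw [← Quotient.out_eq x, ← Quotient.out_eq y]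
  exact Iff.rfl

/-- Solving for a number of orbits of the units, where `U` is the number of units. -/
theorem eq_pow_mul_geom_sum {q L U C e f m : ℕ} (hq : 1 < q) (hU : U + q ^ L = q ^ (L + 1))
    (h : C * U * q ^ f + q ^ (e + L + f) = q ^ (e + L + f + m)) :
    C = q ^ e * ∑ i ∈ Finset.range m, q ^ i := by
  obtain ⟨Q, rfl⟩ : ∃ Q, q = Q + 1 := ⟨q - 1, by omega⟩
  have hU' : U = (Q + 1) ^ L * Q := by
    refine Nat.add_right_cancel (hU.trans ?_)
    ring
  have hG := geom_sum_mul_add Q m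
  set G := ∑ i ∈ Finset.range m, (Q + 1) ^ i
  -- With U = q^L (q − 1), the common factor q^(L+f) (q − 1) cancels, leaving (q^m − 1)/(q − 1) as
  -- the geometric sum.
  have hpos : 0 < (Q + 1) ^ (L + f) * Q := Nat.mul_pos (pow_pos (by omega) _) (by omega)
  refine Nat.eq_of_mul_eq_mul_right hpos (Nat.add_right_cancel (m := (Q + 1) ^ (e + L + f)) ?_)
  rw [hU'] at h
  calc _ = C * ((Q + 1) ^ L * Q) * (Q + 1) ^ f + (Q + 1) ^ (e + L + f) := by ring
    _ = (Q + 1) ^ (e + L + f) * (G * Q + 1) := by rw [h, hG, pow_add]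
    _ = _ := by ring

theorem mem_adjacencyEigenvalues_unimodularGraphZero {R : Type*} [CommRing R] [IsLocalRing R]
    [Finite R] {π : R} (hπ : maximalIdeal R = Ideal.span {π})
    (hq : Odd (Nat.card (ResidueField R))) (p : ℕ) (z : ℂ) :
    z ∈ adjacencyEigenvalues (unimodularGraphZero R (p + 3)) ↔
      ∃ i ≤ nilpotencyClass π, z ^ 2 =
        (umZeroEigenvalueSq (Nat.card (ResidueField R)) (nilpotencyClass π) p i : ℂ) := by
  classical
  have : Fintype (ProjUnimodularTuple R (p + 3)) := Fintype.ofFinite _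
  have hq2 := two_lt_card_residueField hq
  have hℓ := nilpotencyClass_uniformizer_pos hπ
  have hnil := pow_nilpotencyClass_uniformizer hπ
  unfold unimodularGraphZero
  rw [mem_adjacencyEigenvalues_bipartiteGraphOf (fun x y h => by
    induction x using Quotient.inductionOn with | _ a
    induction y using Quotient.inductionOn with | _ b
    have h' : dotProduct a.1 b.1 = 0 := h
    rw [dotProduct_comm] at h'
    exact h')]
  have hU := card_units_add hπ
  have hV := card_unimodularTuple hπ (p + 3)
  have hcl := fun k (h1 : 1 ≤ k) (h2 : k ≤ nilpotencyClass π) =>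
    card_scalingSetoid_class_zero (n := p + 3) hπ h1 h2
  have hlow := fun k (hk : k < nilpotencyClass π) a b h h' =>
    card_orthogonal_of_scaling (n := p + 1) hπ (k := k) hk (a := a) (b := b) h h'
  have htop := fun a b h => card_orthogonal_of_scaling_top (n := p + 2) hπ (a := a) (b := b) h
  set q := Nat.card (ResidueField R) with hqdef
  set ℓ := nilpotencyClass π with hℓdef
  obtain ⟨L, hL⟩ : ∃ L, ℓ = L + 1 := ⟨ℓ - 1, by omega⟩
  have hU' : Nat.card Rˣ + q ^ L = q ^ (L + 1) := by rwa [hL, Nat.add_sub_cancel] at hU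
  have : Nonempty (ProjUnimodularTuple R (p + 3)) :=
    ⟨Quotient.mk _ ⟨fun _ => 1, span_range_eq_top_iff.2 ⟨0, isUnit_one⟩⟩⟩
  refine hasEigenvalue_chain_iff (r := fun k => projSetoid π (p + 3) k)
    (s := umZeroClassCard q ℓ p) (N := fun i => (umZeroCommonNeighbors q ℓ p i : ℂ))
    (θ := fun i => (umZeroEigenvalueSq q ℓ p i : ℂ)) (m := ℓ) ?_ ?_ ?_ ?_
    (fun i hi => umZeroClassCard_succ_lt hq2 hi) ?_ (umZeroEigenvalueSq_zero hℓ)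
    (fun i hi => umZeroEigenvalueSq_succ hi) ?_ (z ^ 2)
  · exact fun i j hij x y h => scalingSetoid_mono le_rfl hij h
  · refine top_le_iff.1 fun x y _ => ?_
    change scalingSetoid π (p + 3) 0 0 x.out y.out
    rw [scalingSetoid_zero_zero]
    trivial
  · refine le_bot_iff.1 fun x y h => ?_
    obtain ⟨u, -, hu⟩ := h
    change x = y
    rw [← Quotient.out_eq x, ← Quotient.out_eq y]
    have e : unimodularTupleSetoid R (p + 3) y.out x.out := by
      refine ⟨u, funext fun j => ?_⟩
      have := hu j
      rw [hnil, zero_dvd_iff, sub_eq_zero] at this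
      exact this.symm
    exact (Quotient.sound e).symm
  · intro k hk x
    have h := card_subtype_proj (fun y => projSetoid π (p + 3) k x y)
    rw [Nat.card_congr (Equiv.subtypeEquivRight fun b => projSetoid_mk_iff)] at h
    rcases Nat.eq_zero_or_pos k with rfl | hk1
    · rw [umZeroClassCard]
      refine eq_pow_mul_geom_sum (L := L) (U := Nat.card Rˣ) (f := 0) (by omega) hU' ?_
      rw [← h, scalingSetoid_zero_zero]
      have h2 : Nat.card {b : UnimodularTuple R (p + 3) //
          (⊤ : Setoid (UnimodularTuple R (p + 3))) x.out b} =
          Nat.card (UnimodularTuple R (p + 3)) :=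
        Nat.card_congr (Equiv.subtypeUnivEquiv fun _ => trivial)
      rw [h2, show ℓ - 1 = L by omega]
      rw [hL, Nat.add_sub_cancel] at hV
      linear_combination hV
    · obtain ⟨k, rfl⟩ : ∃ j, k = j + 1 := ⟨k - 1, by omega⟩
      rw [umZeroClassCard, ← mul_one (q ^ _)]
      -- With m = 1 the geometric sum is 1, so the same division by |R^×| yields a pure power of q.
      have h1 := eq_pow_mul_geom_sum (q := q) (L := L) (U := Nat.card Rˣ) (f := 0) (m := 1)
        (C := Nat.card {y // projSetoid π (p + 3) (k + 1) x y}) (e := (p + 2) * (ℓ - (k + 1)))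
        (by omega) hU' ?_
      · simpa using h1
      · have h2 := hcl (k + 1) hk1 hk x.out
        rw [h, show p + 3 - 1 = p + 2 by omega] at h2
        rw [show ℓ - 1 = L by omega, show q ^ ℓ = q ^ (L + 1) by rw [hL]] at h2
        linear_combination h2
  · intro k hk x y h h'
    rw [relMatrix_mul_apply, Nat.cast_inj]
    have hc := card_subtype_proj (fun c => x.Orthogonal c ∧ c.Orthogonal y)
    rw [Nat.card_congr (Equiv.subtypeEquivRight fun b => orthogonal_mk_iff)] at hc
    rw [umZeroCommonNeighbors]
    -- At k = ℓ the two points coincide and the two orthogonality conditions collapse to one.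
    rcases Nat.lt_or_ge k ℓ with hk' | hk'
    · rw [if_pos hk']
      refine eq_pow_mul_geom_sum (L := L) (U := Nat.card Rˣ) (f := p + 1) (by omega) hU' ?_
      have h1 := hlow k hk' x.out y.out h (h' hk')
      rw [hc, hL] at h1
      rw [hL, Nat.add_sub_cancel]
      linear_combination h1
    · obtain rfl : k = ℓ := by omega
      rw [if_neg (by omega)]
      refine eq_pow_mul_geom_sum (L := L) (U := Nat.card Rˣ) (f := p + 2) (by omega) hU' ?_
      have h1 := htop x.out y.out h
      rw [hc, hL] at h1
      rw [hL, Nat.add_sub_cancel]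
      linear_combination h1
  · simp [umZeroEigenvalueSq]

theorem adjacencyEigenvalues_unimodularGraphZero {R : Type*} [CommRing R] [Finite R]
    [IsLocalRing R] {π : R} (hπ : maximalIdeal R = Ideal.span {π}) {q ℓ n : ℕ}
    (hq : q = Nat.card (ResidueField R)) (hq_odd : Odd q) (hℓ : ℓ = nilpotencyClass π)
    (hn : 3 ≤ n) :
    adjacencyEigenvalues (unimodularGraphZero R n) =
      (fun x : ℝ => (x : ℂ)) ''
        {x : ℝ |
          (x = (q : ℝ) ^ (((n : ℝ) - 2) * (ℓ - 1)) * (((q : ℝ) ^ (n - 1) - 1) / (q - 1)) ∨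
            x = -((q : ℝ) ^ (((n : ℝ) - 2) * (ℓ - 1)) *
              (((q : ℝ) ^ (n - 1) - 1) / (q - 1)))) ∨
          (∃ k : ℕ, 1 ≤ k ∧ k ≤ ℓ ∧
            (x = (q : ℝ) ^ (((n : ℝ) - 2) * (ℓ - k / 2)) ∨
              x = -(q : ℝ) ^ (((n : ℝ) - 2) * (ℓ - k / 2))))} := by
  obtain ⟨p, rfl⟩ : ∃ p, n = p + 3 := ⟨n - 3, by omega⟩
  have hpos : 0 < ℓ := by rw [hℓ]; exact nilpotencyClass_uniformizer_pos hπ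
  have hq2 : 2 < q := by
    rw [hq]
    exact two_lt_card_residueField (hq ▸ hq_odd)
  have hd : (q : ℝ) ^ ((((p + 3 : ℕ) : ℝ) - 2) * (ℓ - 1)) *
      (((q : ℝ) ^ (p + 3 - 1) - 1) / (q - 1)) =
      ((q ^ ((ℓ - 1) * (p + 1)) * ∑ i ∈ Finset.range (p + 2), q ^ i : ℕ) : ℝ) := by
    have hq1 : (q : ℝ) ≠ 1 := by
      exact_mod_cast (by omega : q ≠ 1)
    rw [show p + 3 - 1 = p + 2 by omega, ← geom_sum_eq hq1]
    push_cast
    rw [← Real.rpow_natCast]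
    congr 2
    push_cast [Nat.cast_sub (show 1 ≤ ℓ from hpos)]
    ring
  rw [hd]
  ext z
  rw [mem_adjacencyEigenvalues_unimodularGraphZero hπ (hq ▸ hq_odd), ← hq, ← hℓ]
  set D := q ^ ((ℓ - 1) * (p + 1)) * ∑ i ∈ Finset.range (p + 2), q ^ i with hD
  have h0 : z ^ 2 = (umZeroEigenvalueSq q ℓ p 0 : ℂ) ↔
      z = ((D : ℝ) : ℂ) ∨ z = ((-(D : ℝ) : ℝ) : ℂ) := by
    rw [umZeroEigenvalueSq, ← hD, Nat.cast_pow, sq_eq_sq_iff_eq_or_eq_neg]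
    push_cast
    rfl
  have hk : ∀ k, 1 ≤ k → k ≤ ℓ → (z ^ 2 = (umZeroEigenvalueSq q ℓ p k : ℂ) ↔
      z = (((q : ℝ) ^ ((((p + 3 : ℕ) : ℝ) - 2) * (ℓ - k / 2)) : ℝ) : ℂ) ∨
      z = ((-(q : ℝ) ^ ((((p + 3 : ℕ) : ℝ) - 2) * (ℓ - k / 2)) : ℝ) : ℂ)) := by
    intro k hk1 hk2
    obtain ⟨j, rfl⟩ : ∃ j, k = j + 1 := ⟨k - 1, by omega⟩
    rw [umZeroEigenvalueSq, if_pos (by omega)]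
    refine sq_eq_natCast_pow_iff ?_ z
    push_cast [Nat.cast_sub (show j + 1 ≤ 2 * ℓ by omega)]
    ring
  constructor
  · rintro ⟨k, hkℓ, h⟩
    rcases Nat.eq_zero_or_pos k with rfl | hk1
    · rcases h0.1 h with h | h
      · exact ⟨_, Or.inl (Or.inl rfl), h.symm⟩
      · exact ⟨_, Or.inl (Or.inr rfl), h.symm⟩
    · rcases (hk k hk1 hkℓ).1 h with h | h
      · exact ⟨_, Or.inr ⟨k, hk1, hkℓ, Or.inl rfl⟩, h.symm⟩
      · exact ⟨_, Or.inr ⟨k, hk1, hkℓ, Or.inr rfl⟩, h.symm⟩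
  · rintro ⟨x, h | ⟨k, hk1, hkℓ, h⟩, rfl⟩
    · exact ⟨0, Nat.zero_le _, h0.2 (h.imp (congrArg _) (congrArg _))⟩
    · exact ⟨k, hkℓ, (hk k hk1 hkℓ).2 (h.imp (congrArg _) (congrArg _))⟩

end UmZeroSpectrum

/-! ### Main theorem -/

theorem mainTheorem2 {R : Type*} [CommRing R] [Finite R] [IsLocalRing R]
    [IsPrincipalIdealRing R] (π : R) (hπ : IsLocalRing.maximalIdeal R = Ideal.span {π})
    (q ℓ n : ℕ) (hq : q = Nat.card (IsLocalRing.ResidueField R)) (hq_odd : Odd q)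
    (hℓ : ℓ = nilpotencyClass π) :
    (2 ≤ n →
      adjacencyEigenvalues (unimodularGraph R n) =
        (fun x : ℝ => (x : ℂ)) ''
          {x : ℝ |
            (x = (q : ℝ) ^ (((n : ℝ) - 1) * ℓ) ∨ x = -(q : ℝ) ^ (((n : ℝ) - 1) * ℓ)) ∨
            (x = (q : ℝ) ^ (((n : ℝ) - 1) * ℓ - n / 2) ∨
              x = -(q : ℝ) ^ (((n : ℝ) - 1) * ℓ - n / 2)) ∨
            (∃ k : ℕ, 1 ≤ k ∧ k ≤ ℓ ∧
              (x = (q : ℝ) ^ (((n : ℝ) - 1) * (ℓ - k / 2)) ∨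
                x = -(q : ℝ) ^ (((n : ℝ) - 1) * (ℓ - k / 2)))) ∨
            (¬ IsField R ∧ x = 0)}) ∧
    (3 ≤ n →
      adjacencyEigenvalues (unimodularGraphZero R n) =
        (fun x : ℝ => (x : ℂ)) ''
          {x : ℝ |
            (x = (q : ℝ) ^ (((n : ℝ) - 2) * (ℓ - 1)) * (((q : ℝ) ^ (n - 1) - 1) / (q - 1)) ∨
              x = -((q : ℝ) ^ (((n : ℝ) - 2) * (ℓ - 1)) *
                (((q : ℝ) ^ (n - 1) - 1) / (q - 1)))) ∨
            (∃ k : ℕ, 1 ≤ k ∧ k ≤ ℓ ∧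
              (x = (q : ℝ) ^ (((n : ℝ) - 2) * (ℓ - k / 2)) ∨
                x = -(q : ℝ) ^ (((n : ℝ) - 2) * (ℓ - k / 2))))}) := by
  exact ⟨fun hn => adjacencyEigenvalues_unimodularGraph hπ hq hq_odd hℓ hn,
    fun hn => adjacencyEigenvalues_unimodularGraphZero hπ hq hq_odd hℓ hn⟩
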